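/- Let $\gamma>0$, $0<b<c<d$, let $\mathcal K$ be a compact subset of $C^\infty([0,d];\mathbb R)$ (Fréchet topology) and $K\subset(0,+\infty)$ a compact set. Let $\mathcal V$ be the set of all potentials $V:[0,\infty)\to\mathbb R$ that are continuous on $[0,\infty)$, smooth on $(0,\infty)$, with $V(0)=0$, such that * $V(x)=x^\gamma W(x)$ for $x>0$, with $W$ smooth on $[0,\infty)$, $W(0)>0$ and $W|_{[0,d]}\in\mathcal K$; * $V(x)\ge V(d)$ for all $x\ge d$, and $V'(x)>0$ for all $x\in(0,d]$; * for all $E\in K$: $E-V>0$ on $[0,b]$ and $V-E>0$ on $[c,d]$. Assume that every element of $\mathcal K$ is the restriction $W|_{[0,d]}$ for some $V=x^\gamma W\in\mathcal V$ (so that the set of restrictions to $[0,d]$ of the $W$'s is compact). For $V\in\mathcal V$, $h>0$ and $E\in(0,V(d))$ there is a unique real function $G_h(\cdot\,;E)\in C^2([0,\infty))$ with $$-h^2G''+VG=EG \text{ on } [0,\infty),\qquad \int_0^\infty G^2\,dx=1,\qquad G(x)>0\ \text{ for all } x\ge d .$$ Put $Z_h(E)=G_h(0;E)+ih\,G_h'(0;E)$.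 Then: 1. There are $\mathbf c,h_0>0$, depending only on $\gamma,b,c,d,\mathcal K,K$, such that $|Z_h(E)|\ge\mathbf c$ for all $(V,E)\in\mathcal V\times K$ and all $0<h\le h_0$. 2. For every $V\in\mathcal V$ and $h>0$ there is a differentiable function $\theta_h:(0,V(d))\to\mathbb R$ with $Z_h=|Z_h|e^{i\theta_h}$, and $h\,|Z_h(E)|^2\,\dot\theta_h(E)=1$ for all $E\in(0,V(d))$, where the dot is the derivative in $E$. 3. There are $\mathbf c,h_0>0$, depending only on $\gamma,b,c,d,\mathcal K,K$, such that for all $V\in\mathcal V$, all $0<h\le h_0$, and either the Dirichlet or the Neumann condition at $0$: if $E\in K$ is an eigenvalue of $-h^2\frac{d^2}{dx^2}+V$ on $L^2(0,\infty)$ with this boundary condition, then every other eigenvalue $E'\ne E$ of the same operator satisfies $|E-E'|\ge\mathbf c\,h$. -/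

import Mathlib

open Set MeasureTheory Topology
open scoped ContDiff

noncomputable section

/-- The space `C^∞([0,d]; ℝ)`. Smoothness up to the boundary is tested on the extension by zero;
it only depends on the values on `[0,d]`. -/
structure SmoothIcc (d : ℝ) where
  toFun : Icc (0 : ℝ) d → ℝ
  smooth : ContDiffOn ℝ ∞ (Function.extend Subtype.val toFun 0) (Icc 0 d)

/-- All derivatives `w, w', w'', …` on `[0,d]` (one-sided at the end points), each regarded as an
element of the space of functions on `[0,d]` with the topology of uniform convergence. -/
def SmoothIcc.jet {d : ℝ} (w : SmoothIcc d) : ℕ → UniformFun (Icc (0 : ℝ) d) ℝ :=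
  fun n => UniformFun.ofFun fun x =>
    iteratedDerivWithin n (Function.extend Subtype.val w.toFun 0) (Icc 0 d) x

/-- The Fréchet topology of `C^∞([0,d]; ℝ)`: uniform convergence of every derivative. -/
instance (d : ℝ) : TopologicalSpace (SmoothIcc d) :=
  TopologicalSpace.induced SmoothIcc.jet inferInstance

/-- `w ∈ C^∞([0,d])` is the restriction to `[0,d]` of the function `W`. -/
def SmoothIcc.IsRestrictionOf {d : ℝ} (w : SmoothIcc d) (W : ℝ → ℝ) : Prop :=
  ∀ x : Icc (0 : ℝ) d, w.toFun x = W x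

/-- `V` is a potential on the half-line `[0,∞)` of the form `x^γ W(x)`, increasing on `(0,d]` and
bounded below by `V(d)` beyond `d`. Only the values on `[0,∞)` matter. -/
structure IsWellPotential (γ d : ℝ) (V W : ℝ → ℝ) : Prop where
  smooth : ContDiffOn ℝ ∞ V (Ioi 0)
  continuousOn : ContinuousOn V (Ici 0)
  zero : V 0 = 0
  smooth_factor : ContDiffOn ℝ ∞ W (Ici 0)
  eq_mul : ∀ x, 0 < x → V x = x ^ γ * W x
  factor_pos : 0 < W 0
  le_of_ge : ∀ x, d ≤ x → V d ≤ V x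
  deriv_pos : ∀ x ∈ Ioc 0 d, 0 < deriv V x

/-- The class `𝒱` of potentials attached to `γ`, `b`, `c`, `d`, `𝒦`, `K`. -/
def potentialClass (γ b c d : ℝ) (𝒦 : Set (SmoothIcc d)) (K : Set ℝ) : Set (ℝ → ℝ) :=
  {V | ∃ W : ℝ → ℝ, IsWellPotential γ d V W ∧ (∃ w ∈ 𝒦, w.IsRestrictionOf W) ∧
    (∀ E ∈ K, ∀ x ∈ Icc 0 b, 0 < E - V x) ∧ (∀ E ∈ K, ∀ x ∈ Icc c d, 0 < V x - E)}

/-- `u` is a classical solution of `-h² u'' + V u = E u` on the half-line `[0,∞)`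
(derivatives at `0` are one-sided). -/
structure IsHalfLineSolution (V : ℝ → ℝ) (h E : ℝ) (u : ℝ → ℝ) : Prop where
  contDiffOn : ContDiffOn ℝ 2 u (Ici 0)
  eqn : ∀ x ∈ Ici (0 : ℝ),
    -h ^ 2 * derivWithin (derivWithin u (Ici 0)) (Ici 0) x + V x * u x = E * u x

/-- `G = G_h(· ; E)`: the `L²`-normalized solution that is positive on `[d,∞)`. -/
structure IsNormalizedSolution (V : ℝ → ℝ) (d h E : ℝ) (G : ℝ → ℝ) : Prop where
  solution : IsHalfLineSolution V h E G
  integrable : IntegrableOn (fun x => G x ^ 2) (Ici 0)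
  normalized : ∫ x in Ici 0, G x ^ 2 = 1
  pos : ∀ x, d ≤ x → 0 < G x

/-- The semiclassical Cauchy datum `G(0) + i h G'(0)`. -/
def cauchyDatum (h : ℝ) (G : ℝ → ℝ) : ℂ :=
  (G 0 : ℂ) + Complex.I * (h : ℂ) * ((derivWithin G (Ici 0) 0 : ℝ) : ℂ)

/-- The two boundary conditions at `0`. -/
inductive BoundaryCondition where
  | dirichlet
  | neumann

/-- `u` satisfies the given boundary condition at `0`. -/
def BoundaryCondition.Holds : BoundaryCondition → (ℝ → ℝ) → Prop
  | .dirichlet, u => u 0 = 0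
  | .neumann, u => derivWithin u (Ici 0) 0 = 0

/-- `E` is an eigenvalue of the realization of `-h² u'' + V u` on `L²(0,∞)` with the given
boundary condition at `0`. -/
def IsEigenvalue (bc : BoundaryCondition) (V : ℝ → ℝ) (h E : ℝ) : Prop :=
  ∃ u : ℝ → ℝ, IsHalfLineSolution V h E u ∧ IntegrableOn (fun x => u x ^ 2) (Ici 0) ∧
    bc.Holds u ∧ ∃ x ∈ Ici (0 : ℝ), u x ≠ 0

end

/-!
On `[0, ∞)` the equation `-h² u'' + V u = E u` is the linear system `u' = v`, `v' = q u` with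
`q = (V - E) / h²`, and `q ≥ k²` on `[d, ∞)` with `k = √(V(d) - E) / h`
(`decayRate`). Everything is read off from the signs of derivatives of quadratic expressions in
`u` and `v`.

*The decaying solution.* Where `q ≥ 0`, the function `u²` is convex, so an `L²` solution has
`u v ≤ 0` there (`IsSolutionOn.mul_nonpos_of_integrableOn`). Conversely, `u v ≤ 0` forces
`v² ≥ k² u²` (`IsSolutionOn.sq_mul_sq_le_sq`) and hence exponential decay. Existence is a
compactness argument over the angle of the Cauchy data at `0` (`exists_decaying_solution`); uniqueness
up to a factor holds because a decaying solution which vanishes in the forbidden region is zero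
(`IsHalfLineSolution.eqOn_mul`).

*Lower bound on the Cauchy datum.* The energy `F = h² G'² + (E - V) G²` satisfies `F' = -V' G²`.
It is decreasing on `[0, d]`, is bounded at `0` by the Cauchy datum, and `F(d) ≥ 0` by the bound
`v² ≥ k² u²`. So `F(0)` controls `G²` on `[0, b]`, where `E - V` is bounded below, and `∫ V' G²`
on `[b, d]`; since `G²` is decreasing on `[c, ∞)` and decays at rate `k` beyond `d`, it controls the
total mass, which is `1` (`one_le_mul_norm_cauchyDatum_sq`). The constants are uniform because the
class of potentials is compact (`exists_uniform_margins`).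

*The phase.* For two energies, the Wronskian identity reads
`h Im (conj Z(E) Z(E')) = (E' - E) ∫ G_E G_{E'}` (`IsDecayingSolution.wronskian_eq`). With this
identity, mere continuity of the decaying solution in `E` implies that the argument of `Z` is
differentiable with derivative `1 / (h |Z|²)` (`exists_differentiable_arg`, `exists_phase`).
Continuity in turn comes from the Wronskian identity at `d`, which makes the Cauchy data at `d`
Lipschitz in `E`, and from Gronwall's inequality.

*The spacing.* At eigenvalues with a common boundary condition `Z` lies on one and the same axis, so
the phases at two distinct eigenvalues differ by at least `π`; the lower bound on `|Z|`, valid in a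
neighbourhood of `K`, makes the phase Lipschitz with constant `O(1 / h)`.
-/

/-! ### Linear second-order equations on an interval and on the half-line -/

/-- `(u, v)` solves the first-order system `u' = v`, `v' = q u` on `s`, with derivatives taken
within `s`. -/
structure IsSolutionOn (q u v : ℝ → ℝ) (s : Set ℝ) : Prop where
  deriv_fst : ∀ x ∈ s, HasDerivWithinAt u (v x) s x
  deriv_snd : ∀ x ∈ s, HasDerivWithinAt v (q x * u x) s x

/-- Gronwall's inequality in both directions: `N e^{-Ct}` is decreasing and `N e^{Ct}` is
increasing. -/
theorem le_mul_exp_of_abs_deriv_le {N N' : ℝ → ℝ} {X C : ℝ}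
    (hN : ∀ x ∈ Icc 0 X, HasDerivWithinAt N (N' x) (Icc 0 X) x)
    (hb : ∀ x ∈ Icc 0 X, |N' x| ≤ C * N x) {x y : ℝ} (hx : x ∈ Icc 0 X) (hy : y ∈ Icc 0 X) :
    N x ≤ N y * Real.exp (C * |x - y|) := by
  have hd (σ : ℝ) (z : ℝ) (hz : z ∈ Icc 0 X) :
      HasDerivWithinAt (fun t => N t * Real.exp (σ * t))
        ((N' z + σ * N z) * Real.exp (σ * z)) (Icc 0 X) z := by
    have h1 : HasDerivAt (fun t : ℝ => Real.exp (σ * t)) (Real.exp (σ * z) * (σ * 1)) z :=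
      ((hasDerivAt_id z).const_mul σ).exp
    exact ((hN z hz).mul h1.hasDerivWithinAt).congr_deriv (by ring)
  have hanti : AntitoneOn (fun t => N t * Real.exp (-C * t)) (Icc 0 X) :=
    antitoneOn_of_hasDerivWithinAt_nonpos (convex_Icc 0 X)
      (fun z hz => (hd (-C) z hz).continuousWithinAt)
      (fun z hz => (hd (-C) z (interior_subset hz)).mono interior_subset) fun z hz => by
        have := (abs_le.1 (hb z (interior_subset hz))).2
        exact mul_nonpos_of_nonpos_of_nonneg (by linarith) (Real.exp_pos _).le
  have hmono : MonotoneOn (fun t => N t * Real.exp (C * t)) (Icc 0 X) :=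
    monotoneOn_of_hasDerivWithinAt_nonneg (convex_Icc 0 X)
      (fun z hz => (hd C z hz).continuousWithinAt)
      (fun z hz => (hd C z (interior_subset hz)).mono interior_subset) fun z hz => by
        have := (abs_le.1 (hb z (interior_subset hz))).1
        exact mul_nonneg (by linarith) (Real.exp_pos _).le
  rcases le_total y x with h | h
  · have h1 : N x * Real.exp (-C * x) ≤ N y * Real.exp (-C * y) := hanti hy hx h
    rw [abs_of_nonneg (by linarith)]
    calc N x = N x * Real.exp (-C * x) * Real.exp (C * x) := by
            rw [mul_assoc, ← Real.exp_add]; simp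
      _ ≤ N y * Real.exp (-C * y) * Real.exp (C * x) := by gcongr
      _ = _ := by rw [mul_assoc, ← Real.exp_add]; ring_nf
  · have h1 : N x * Real.exp (C * x) ≤ N y * Real.exp (C * y) := hmono hx hy h
    rw [abs_of_nonpos (by linarith)]
    calc N x = N x * Real.exp (C * x) * Real.exp (-C * x) := by
            rw [mul_assoc, ← Real.exp_add]; simp
      _ ≤ N y * Real.exp (C * y) * Real.exp (-C * x) := by gcongr
      _ = _ := by rw [mul_assoc, ← Real.exp_add]; ring_nf

namespace IsSolutionOn

variable {q u v : ℝ → ℝ} {s : Set ℝ}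

theorem mono {t : Set ℝ} (h : IsSolutionOn q u v s) (hts : t ⊆ s) : IsSolutionOn q u v t :=
  ⟨fun x hx => (h.deriv_fst x (hts hx)).mono hts, fun x hx => (h.deriv_snd x (hts hx)).mono hts⟩

theorem continuousOn_fst (h : IsSolutionOn q u v s) : ContinuousOn u s :=
  fun x hx => (h.deriv_fst x hx).continuousWithinAt

theorem continuousOn_snd (h : IsSolutionOn q u v s) : ContinuousOn v s :=
  fun x hx => (h.deriv_snd x hx).continuousWithinAt

theorem hasDerivAt_fst (h : IsSolutionOn q u v (Ici 0)) {x : ℝ} (hx : 0 < x) :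
    HasDerivAt u (v x) x :=
  (h.deriv_fst x hx.le).hasDerivAt (Ici_mem_nhds hx)

theorem hasDerivAt_snd (h : IsSolutionOn q u v (Ici 0)) {x : ℝ} (hx : 0 < x) :
    HasDerivAt v (q x * u x) x :=
  (h.deriv_snd x hx.le).hasDerivAt (Ici_mem_nhds hx)

theorem linear_comb {u' v' : ℝ → ℝ} (h : IsSolutionOn q u v s) (h' : IsSolutionOn q u' v' s)
    (α β : ℝ) :
    IsSolutionOn q (fun x => α * u x + β * u' x) (fun x => α * v x + β * v' x) s := by
  refine ⟨fun x hx => ((h.deriv_fst x hx).const_mul α).add ((h'.deriv_fst x hx).const_mul β),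
    fun x hx => ?_⟩
  exact (((h.deriv_snd x hx).const_mul α).add
    ((h'.deriv_snd x hx).const_mul β)).congr_deriv (by ring)

theorem const_mul (h : IsSolutionOn q u v s) (α : ℝ) :
    IsSolutionOn q (fun x => α * u x) (fun x => α * v x) s := by
  simpa using h.linear_comb h α 0

/-- Continuous dependence on the Cauchy data and on the coefficient: the difference of two
solutions of `u'' = q u` and `u'' = q₂ u` is estimated by Gronwall's inequality. -/
theorem sq_sub_le {q₂ u₂ v₂ : ℝ → ℝ} {X M ε F : ℝ}
    (h : IsSolutionOn q u v (Icc 0 X)) (h₂ : IsSolutionOn q₂ u₂ v₂ (Icc 0 X))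
    (hM : ∀ x ∈ Icc 0 X, |q₂ x| ≤ M) (hε : ∀ x ∈ Icc 0 X, q₂ x - q x = ε)
    (hF : ∀ x ∈ Icc 0 X, u x ^ 2 ≤ F) {x y : ℝ} (hx : x ∈ Icc 0 X) (hy : y ∈ Icc 0 X) :
    (u₂ x - u x) ^ 2 + (v₂ x - v x) ^ 2 ≤
      ((u₂ y - u y) ^ 2 + (v₂ y - v y) ^ 2 + ε ^ 2 * F) * Real.exp ((M + 2) * X) := by
  have hN0 (z : ℝ) (hz : z ∈ Icc 0 X) :
      0 ≤ (u₂ z - u z) ^ 2 + (v₂ z - v z) ^ 2 + ε ^ 2 * F := by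
    have := (sq_nonneg (u z)).trans (hF z hz)
    positivity
  have hM0 : 0 ≤ M := (abs_nonneg _).trans (hM x hx)
  have key := le_mul_exp_of_abs_deriv_le (X := X) (C := M + 2)
    (N := fun z => (u₂ z - u z) ^ 2 + (v₂ z - v z) ^ 2 + ε ^ 2 * F)
    (N' := fun z => 2 * (u₂ z - u z) * (v₂ z - v z)
      + 2 * (v₂ z - v z) * (q₂ z * u₂ z - q z * u z))
    (fun z hz => by
      exact (((((h₂.deriv_fst z hz).sub (h.deriv_fst z hz)).pow 2).add
        (((h₂.deriv_snd z hz).sub (h.deriv_snd z hz)).pow 2)).add_const (ε ^ 2 * F)).congr_deriv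
          (by simp))
    (fun z hz => by
      have e : q₂ z * u₂ z - q z * u z = q₂ z * (u₂ z - u z) + ε * u z := by
        rw [← hε z hz]; ring
      simp only [e]
      set r := u₂ z - u z
      set t := v₂ z - v z
      have h1 : |2 * r * t| ≤ r ^ 2 + t ^ 2 := by
        rw [abs_le]; constructor <;> nlinarith [sq_nonneg (r + t), sq_nonneg (r - t)]
      have h2 : |2 * t * (q₂ z * r)| ≤ M * (r ^ 2 + t ^ 2) := by
        rw [show 2 * t * (q₂ z * r) = q₂ z * (2 * r * t) by ring, abs_mul]
        exact mul_le_mul (hM z hz) h1 (abs_nonneg _) hM0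
      have h3 : |2 * t * (ε * u z)| ≤ t ^ 2 + ε ^ 2 * F := by
        have : (ε * u z) ^ 2 ≤ ε ^ 2 * F := by
          rw [mul_pow]; exact mul_le_mul_of_nonneg_left (hF z hz) (sq_nonneg _)
        rw [abs_le]
        constructor <;> nlinarith [sq_nonneg (t + ε * u z), sq_nonneg (t - ε * u z)]
      have hF0 : 0 ≤ ε ^ 2 * F :=
        mul_nonneg (sq_nonneg _) ((sq_nonneg (u z)).trans (hF z hz))
      calc |2 * r * t + 2 * t * (q₂ z * r + ε * u z)|
          = |2 * r * t + 2 * t * (q₂ z * r) + 2 * t * (ε * u z)| := by ring_nf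
        _ ≤ |2 * r * t| + |2 * t * (q₂ z * r)| + |2 * t * (ε * u z)| := abs_add_three _ _ _
        _ ≤ (M + 2) * (r ^ 2 + t ^ 2 + ε ^ 2 * F) := by
            nlinarith [mul_nonneg hM0 hF0, sq_nonneg r, sq_nonneg t])
    hx hy
  have hF0 : 0 ≤ ε ^ 2 * F :=
    mul_nonneg (sq_nonneg _) ((sq_nonneg (u x)).trans (hF x hx))
  refine (le_add_of_nonneg_right hF0).trans (key.trans ?_)
  have : |x - y| ≤ X := by
    rw [abs_le]; constructor <;> linarith [hx.1, hx.2, hy.1, hy.2]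
  have h0 := hN0 y hy
  gcongr

theorem eqOn_Icc {u₂ v₂ : ℝ → ℝ} {X : ℝ} (hq : ContinuousOn q (Icc 0 X))
    (h : IsSolutionOn q u v (Icc 0 X)) (h₂ : IsSolutionOn q u₂ v₂ (Icc 0 X)) {y : ℝ}
    (hy : y ∈ Icc 0 X) (hu : u₂ y = u y) (hv : v₂ y = v y) {x : ℝ} (hx : x ∈ Icc 0 X) :
    u₂ x = u x ∧ v₂ x = v x := by
  obtain ⟨M, hM⟩ := isCompact_Icc.exists_bound_of_continuousOn hq
  obtain ⟨F, hF⟩ := isCompact_Icc.exists_bound_of_continuousOn (h.continuousOn_fst.pow 2)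
  have := h.sq_sub_le h₂ (ε := 0) hM (fun z _ => sub_self _)
    (fun z hz => (le_abs_self _).trans (hF z hz)) hx hy
  rw [hu, hv] at this
  simp only [sub_self, ne_eq, OfNat.ofNat_ne_zero, not_false_eq_true, zero_pow, add_zero,
    zero_mul] at this
  constructor <;> nlinarith [sq_nonneg (u₂ x - u x), sq_nonneg (v₂ x - v x)]

theorem eqOn_Ici {u₂ v₂ : ℝ → ℝ} (hq : ContinuousOn q (Ici 0))
    (h : IsSolutionOn q u v (Ici 0)) (h₂ : IsSolutionOn q u₂ v₂ (Ici 0)) {y : ℝ}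
    (hy : 0 ≤ y) (hu : u₂ y = u y) (hv : v₂ y = v y) {x : ℝ} (hx : 0 ≤ x) :
    u₂ x = u x ∧ v₂ x = v x :=
  eqOn_Icc (X := max x y) (hq.mono Icc_subset_Ici_self) (h.mono Icc_subset_Ici_self)
    (h₂.mono Icc_subset_Ici_self) ⟨hy, le_max_right _ _⟩ hu hv ⟨hx, le_max_left _ _⟩

theorem eq_zero (hq : ContinuousOn q (Ici 0)) (h : IsSolutionOn q u v (Ici 0)) {y : ℝ}
    (hy : 0 ≤ y) (hu : u y = 0) (hv : v y = 0) {x : ℝ} (hx : 0 ≤ x) : u x = 0 ∧ v x = 0 := by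
  have h0 : IsSolutionOn q (fun _ => 0) (fun _ => 0) (Ici 0) := by
    simpa using h.const_mul 0
  exact h0.eqOn_Ici hq h hy hu hv hx

end IsSolutionOn

/-- Truncation of `y` to `[-R, R]`. -/
def clamp (R y : ℝ) : ℝ := max (-R) (min R y)

theorem abs_clamp_sub_le (R y z : ℝ) : |clamp R y - clamp R z| ≤ |y - z| := by
  unfold clamp
  exact (abs_max_sub_max_le_max _ _ _ _).trans (by simpa using abs_min_sub_min_le_max R y R z)

theorem abs_clamp_le {R : ℝ} (hR : 0 ≤ R) (y : ℝ) : |clamp R y| ≤ R := by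
  unfold clamp
  rw [abs_le]
  exact ⟨le_max_left _ _, max_le (by linarith) (min_le_left _ _)⟩

theorem clamp_eq_self {R y : ℝ} (h : |y| ≤ R) : clamp R y = y := by
  unfold clamp
  rw [abs_le] at h
  rw [min_eq_right h.2, max_eq_right h.1]

theorem abs_clamp_le_abs {R : ℝ} (hR : 0 ≤ R) (y : ℝ) : |clamp R y| ≤ |y| := by
  simpa [clamp_eq_self (show |(0 : ℝ)| ≤ R by simpa using hR)] using abs_clamp_sub_le R y 0

/-- Linear equations have solutions on all of `[0, X]`. The vector field is made bounded by
truncation, so that one application of the Picard–Lindelöf theorem covers the whole interval, and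
Gronwall's inequality shows that the truncation level is never reached. -/
theorem exists_isSolutionOn_Icc {q : ℝ → ℝ} {X : ℝ} (hX : 0 ≤ X) (hq : ContinuousOn q (Icc 0 X))
    (a b : ℝ) : ∃ u v, u 0 = a ∧ v 0 = b ∧ IsSolutionOn q u v (Icc 0 X) := by
  obtain ⟨M, hM⟩ := isCompact_Icc.exists_bound_of_continuousOn hq
  have h0 : (0 : ℝ) ∈ Icc 0 X := ⟨le_rfl, hX⟩
  have hM0 : 0 ≤ M := (norm_nonneg _).trans (hM 0 h0)
  -- the a priori bound given by Gronwall's inequality for `u ^ 2 + v ^ 2`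
  set R : ℝ := Real.sqrt ((a ^ 2 + b ^ 2) * Real.exp ((M + 1) * X)) with hRdef
  have hR : 0 ≤ R := Real.sqrt_nonneg _
  let f : ℝ → ℝ × ℝ → ℝ × ℝ := fun t p => (clamp R p.2, q t * clamp R p.1)
  let L : NNReal := ⟨(M + 1) * R, by positivity⟩
  let k : NNReal := ⟨M + 1, by positivity⟩
  let A : NNReal := ⟨(M + 1) * R * X, by positivity⟩
  have hPL : IsPicardLindelof f (⟨0, h0⟩ : Icc (0 : ℝ) X) ((a, b) : ℝ × ℝ) A 0 L k := by
    constructor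
    · intro t ht
      refine LipschitzWith.lipschitzOnWith (LipschitzWith.of_dist_le_mul fun p p' => ?_)
      have h1 := abs_clamp_sub_le R p.2 p'.2
      have h2 := abs_clamp_sub_le R p.1 p'.1
      have h3 : |p.2 - p'.2| ≤ dist p p' := by
        rw [Prod.dist_eq, Real.dist_eq, Real.dist_eq]; exact le_max_right _ _
      have h4 : |p.1 - p'.1| ≤ dist p p' := by
        rw [Prod.dist_eq, Real.dist_eq, Real.dist_eq]; exact le_max_left _ _
      have h5 := hM t ht
      rw [Real.norm_eq_abs] at h5
      have hd : 0 ≤ dist p p' := dist_nonneg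
      change dist (f t p) (f t p') ≤ (M + 1) * dist p p'
      rw [Prod.dist_eq, Real.dist_eq, Real.dist_eq]
      refine max_le ?_ ?_
      · change |clamp R p.2 - clamp R p'.2| ≤ _
        nlinarith [mul_nonneg hM0 hd]
      · change |q t * clamp R p.1 - q t * clamp R p'.1| ≤ _
        rw [← mul_sub, abs_mul]
        calc |q t| * |clamp R p.1 - clamp R p'.1| ≤ M * dist p p' :=
              mul_le_mul h5 (h2.trans h4) (abs_nonneg _) hM0
          _ ≤ _ := by nlinarith
    · intro p _
      exact continuousOn_const.prodMk (hq.mul continuousOn_const)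
    · intro t ht p _
      have h5 := hM t ht
      rw [Real.norm_eq_abs] at h5
      change ‖f t p‖ ≤ (M + 1) * R
      rw [Prod.norm_def, Real.norm_eq_abs, Real.norm_eq_abs]
      refine max_le ?_ ?_
      · change |clamp R p.2| ≤ _
        nlinarith [abs_clamp_le hR p.2, mul_nonneg hM0 hR]
      · change |q t * clamp R p.1| ≤ _
        rw [abs_mul]
        calc |q t| * |clamp R p.1| ≤ M * R :=
              mul_le_mul h5 (abs_clamp_le hR _) (abs_nonneg _) hM0
          _ ≤ _ := by nlinarith
    · change (M + 1) * R * max (X - 0) (0 - 0) ≤ (M + 1) * R * X - 0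
      simp [hX]
  obtain ⟨α, hα0, hα⟩ := hPL.exists_eq_forall_mem_Icc_hasDerivWithinAt₀
  have h1 : ∀ t ∈ Icc 0 X,
      HasDerivWithinAt (fun t => (α t).1) (clamp R (α t).2) (Icc 0 X) t :=
    fun t ht => (hα t ht).fst
  have h2 : ∀ t ∈ Icc 0 X,
      HasDerivWithinAt (fun t => (α t).2) (q t * clamp R (α t).1) (Icc 0 X) t :=
    fun t ht => (hα t ht).snd
  change α 0 = (a, b) at hα0
  have hbd : ∀ t ∈ Icc 0 X, (α t).1 ^ 2 + (α t).2 ^ 2 ≤ R ^ 2 := by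
    intro t ht
    have key := le_mul_exp_of_abs_deriv_le (X := X) (C := M + 1)
      (N := fun z => (α z).1 ^ 2 + (α z).2 ^ 2)
      (N' := fun z => 2 * (α z).1 * clamp R (α z).2 + 2 * (α z).2 * (q z * clamp R (α z).1))
      (fun z hz => by
        exact (((h1 z hz).pow 2).add ((h2 z hz).pow 2)).congr_deriv (by simp))
      (fun z hz => by
        have h5 := hM z hz
        rw [Real.norm_eq_abs] at h5
        have e1 : |2 * (α z).1 * clamp R (α z).2| ≤ 2 * |(α z).1| * |(α z).2| := by
          rw [abs_mul, abs_mul, abs_two]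
          exact mul_le_mul_of_nonneg_left (abs_clamp_le_abs hR _) (by positivity)
        have e2 : |2 * (α z).2 * (q z * clamp R (α z).1)| ≤
            2 * |(α z).2| * (M * |(α z).1|) := by
          rw [abs_mul, abs_mul, abs_two, abs_mul]
          exact mul_le_mul_of_nonneg_left
            (mul_le_mul h5 (abs_clamp_le_abs hR _) (abs_nonneg _) hM0) (by positivity)
        have e3 : 2 * |(α z).1| * |(α z).2| ≤ (α z).1 ^ 2 + (α z).2 ^ 2 := by
          rw [← sq_abs (α z).1, ← sq_abs (α z).2]
          nlinarith [sq_nonneg (|(α z).1| - |(α z).2|)]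
        refine (abs_add_le _ _).trans ?_
        nlinarith [mul_le_mul_of_nonneg_left e3 hM0])
      ht h0
    simp only [hα0] at key
    rw [hRdef, Real.sq_sqrt (by positivity)]
    refine key.trans ?_
    have : |t - 0| ≤ X := by rw [sub_zero, abs_of_nonneg ht.1]; exact ht.2
    gcongr
  have hc : ∀ t ∈ Icc 0 X, clamp R (α t).1 = (α t).1 ∧ clamp R (α t).2 = (α t).2 := by
    intro t ht
    have := hbd t ht
    exact ⟨clamp_eq_self (abs_le_of_sq_le_sq (by nlinarith [sq_nonneg (α t).2]) hR),
      clamp_eq_self (abs_le_of_sq_le_sq (by nlinarith [sq_nonneg (α t).1]) hR)⟩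
  refine ⟨fun t => (α t).1, fun t => (α t).2, by simp [hα0], by simp [hα0], ?_, ?_⟩
  · intro t ht
    have := h1 t ht
    rwa [(hc t ht).2] at this
  · intro t ht
    have := h2 t ht
    rwa [(hc t ht).1] at this

/-- Solutions on the half-line are glued from solutions on the intervals `[0, n]`; at `x` the one on
`[0, ⌊x⌋ + 1]` is used. -/
theorem exists_isSolutionOn_Ici {q : ℝ → ℝ} (hq : ContinuousOn q (Ici 0)) (a b : ℝ) :
    ∃ u v, u 0 = a ∧ v 0 = b ∧ IsSolutionOn q u v (Ici 0) := by
  have hqX (n : ℕ) : ContinuousOn q (Icc 0 (n : ℝ)) := hq.mono Icc_subset_Ici_self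
  choose U W hU hW hs using fun n : ℕ => exists_isSolutionOn_Icc n.cast_nonneg (hqX n) a b
  have hagree : ∀ {n m : ℕ} {x : ℝ}, 0 ≤ x → x ≤ n → x ≤ m → U n x = U m x ∧ W n x = W m x := by
    intro n m x hx hn hm
    exact IsSolutionOn.eqOn_Icc (X := x) (hq.mono Icc_subset_Ici_self)
      ((hs m).mono (Icc_subset_Icc_right hm)) ((hs n).mono (Icc_subset_Icc_right hn))
      (y := 0) ⟨le_rfl, hx⟩ (by rw [hU, hU]) (by rw [hW, hW]) ⟨hx, le_rfl⟩
  have hfl (x : ℝ) : x ≤ ((⌊x⌋₊ + 1 : ℕ) : ℝ) := by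
    push_cast; exact (Nat.lt_floor_add_one x).le
  have hev (x : ℝ) : ∀ᶠ y in 𝓝[Ici 0] x,
      U (⌊y⌋₊ + 1) y = U (⌊x⌋₊ + 1) y ∧ W (⌊y⌋₊ + 1) y = W (⌊x⌋₊ + 1) y := by
    have h1 : ∀ᶠ y in 𝓝[Ici 0] x, y < ((⌊x⌋₊ + 1 : ℕ) : ℝ) :=
      mem_nhdsWithin_of_mem_nhds (Iio_mem_nhds (by push_cast; exact Nat.lt_floor_add_one x))
    filter_upwards [h1, self_mem_nhdsWithin] with y hy hy0
    exact hagree hy0 (hfl y) hy.le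
  have hset (x : ℝ) (hx : 0 ≤ x) : Icc 0 (((⌊x⌋₊ + 1 : ℕ) : ℝ)) ∈ 𝓝[Ici 0] x := by
    have : Iio (((⌊x⌋₊ + 1 : ℕ) : ℝ)) ∈ 𝓝[Ici 0] x :=
      mem_nhdsWithin_of_mem_nhds (Iio_mem_nhds (by push_cast; exact Nat.lt_floor_add_one x))
    filter_upwards [this, self_mem_nhdsWithin] with y hy hy0 using ⟨hy0, le_of_lt hy⟩
  refine ⟨fun x => U (⌊x⌋₊ + 1) x, fun x => W (⌊x⌋₊ + 1) x, by simp [hU], by simp [hW], ?_, ?_⟩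
  · intro x hx
    exact (((hs _).deriv_fst x ⟨hx, hfl x⟩).mono_of_mem_nhdsWithin
      (hset x hx)).congr_of_eventuallyEq
      ((hev x).mono fun y hy => hy.1) rfl
  · intro x hx
    exact (((hs _).deriv_snd x ⟨hx, hfl x⟩).mono_of_mem_nhdsWithin
      (hset x hx)).congr_of_eventuallyEq
      ((hev x).mono fun y hy => hy.2) rfl

/-! ### Decaying solutions in a forbidden region -/

theorem monotoneOn_Ici_of_hasDerivAt_nonneg {f f' : ℝ → ℝ} {a : ℝ} (hc : ContinuousOn f (Ici a))
    (hd : ∀ x, a < x → HasDerivAt f (f' x) x) (h0 : ∀ x, a < x → 0 ≤ f' x) :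
    MonotoneOn f (Ici a) := by
  refine monotoneOn_of_hasDerivWithinAt_nonneg (f' := f') (convex_Ici a) hc ?_ ?_ <;>
    rw [interior_Ici]
  · exact fun x hx => (hd x hx).hasDerivWithinAt
  · exact h0

theorem antitoneOn_Ici_of_hasDerivAt_nonpos {f f' : ℝ → ℝ} {a : ℝ} (hc : ContinuousOn f (Ici a))
    (hd : ∀ x, a < x → HasDerivAt f (f' x) x) (h0 : ∀ x, a < x → f' x ≤ 0) :
    AntitoneOn f (Ici a) := by
  refine antitoneOn_of_hasDerivWithinAt_nonpos (f' := f') (convex_Ici a) hc ?_ ?_ <;>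
    rw [interior_Ici]
  · exact fun x hx => (hd x hx).hasDerivWithinAt
  · exact h0

theorem not_integrableOn_Ici_of_le {f : ℝ → ℝ} {a η : ℝ} (hη : 0 < η)
    (h : ∀ x, a ≤ x → η ≤ f x) : ¬ IntegrableOn f (Ici a) := by
  intro hf
  have : IntegrableOn (fun _ : ℝ => η) (Ici a) := by
    refine Integrable.mono' hf aestronglyMeasurable_const ?_
    filter_upwards [ae_restrict_mem measurableSet_Ici] with x hx
    rw [Real.norm_eq_abs, abs_of_pos hη]
    exact h x hx
  rw [integrableOn_const_iff] at this
  simp [hη.ne'] at this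

theorem integrableOn_exp_neg_sub {k : ℝ} (hk : 0 < k) (a b : ℝ) :
    IntegrableOn (fun x => Real.exp (-(k * (x - a)))) (Ioi b) := by
  have : (fun x => Real.exp (-(k * (x - a)))) =
      fun x => Real.exp (k * a) * Real.exp (-k * x) := by
    ext x; rw [← Real.exp_add]; ring_nf
  rw [this]
  exact (integrableOn_exp_mul_Ioi (neg_lt_zero.2 hk) b).const_mul (Real.exp (k * a))

theorem integral_exp_neg_sub {k : ℝ} (hk : 0 < k) (a : ℝ) :
    ∫ x in Ioi a, Real.exp (-(k * (x - a))) = 1 / k := by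
  have : ∀ x, Real.exp (-(k * (x - a))) = Real.exp (k * a) * Real.exp (-k * x) := fun x => by
    rw [← Real.exp_add]; ring_nf
  simp_rw [this]
  rw [integral_const_mul, integral_exp_mul_Ioi (neg_lt_zero.2 hk), mul_div_assoc', mul_neg,
    ← Real.exp_add, neg_div_neg_eq]
  simp

theorem integrableOn_Ici_of_continuousOn {f : ℝ → ℝ} (hf : ContinuousOn f (Ici 0)) {a : ℝ}
    (hfi : IntegrableOn f (Ioi a)) : IntegrableOn f (Ici 0) := by
  have h1 : IntegrableOn f (Icc 0 a) := (hf.mono Icc_subset_Ici_self).integrableOn_Icc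
  refine (h1.union hfi).mono_set fun x hx => ?_
  rcases le_or_gt x a with h | h
  · exact Or.inl ⟨hx, h⟩
  · exact Or.inr h

namespace IsSolutionOn

variable {q u v : ℝ → ℝ} {a : ℝ}

theorem monotoneOn_mul (h : IsSolutionOn q u v (Ici 0)) (ha : 0 ≤ a)
    (hq : ∀ x, a ≤ x → 0 ≤ q x) : MonotoneOn (fun x => u x * v x) (Ici a) := by
  have hsub : Ici a ⊆ Ici (0 : ℝ) := Ici_subset_Ici.2 ha
  refine monotoneOn_Ici_of_hasDerivAt_nonneg
    ((h.continuousOn_fst.mono hsub).mul (h.continuousOn_snd.mono hsub))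
    (fun x hx => (h.hasDerivAt_fst (ha.trans_lt hx)).mul (h.hasDerivAt_snd (ha.trans_lt hx)))
    fun x hx => ?_
  have := hq x hx.le
  nlinarith [sq_nonneg (v x), mul_nonneg this (sq_nonneg (u x))]

theorem hasDerivAt_sq (h : IsSolutionOn q u v (Ici 0)) {x : ℝ} (hx : 0 < x) :
    HasDerivAt (fun x => u x ^ 2) (2 * (u x * v x)) x :=
  ((h.hasDerivAt_fst hx).pow 2).congr_deriv (by simp; ring)

/-- In a classically forbidden region `u²` is convex, so an `L²` solution has `u²` decreasing
there. -/
theorem mul_nonpos_of_integrableOn (h : IsSolutionOn q u v (Ici 0)) (ha : 0 ≤ a)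
    (hq : ∀ x, a ≤ x → 0 ≤ q x) (hi : IntegrableOn (fun x => u x ^ 2) (Ici 0)) {x : ℝ}
    (hx : a ≤ x) : u x * v x ≤ 0 := by
  by_contra! hp
  have hx0 : 0 ≤ x := ha.trans hx
  have hmono : MonotoneOn (fun y => u y ^ 2 - 2 * (u x * v x) * y) (Ici x) := by
    refine monotoneOn_Ici_of_hasDerivAt_nonneg
      (f' := fun y => 2 * (u y * v y) - 2 * (u x * v x) * 1)
      (((h.continuousOn_fst.mono (Ici_subset_Ici.2 hx0)).pow 2).sub (by fun_prop))
      (fun y hy => (h.hasDerivAt_sq (hx0.trans_lt hy)).sub ((hasDerivAt_id y).const_mul _))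
      fun y hy => ?_
    have := h.monotoneOn_mul ha hq hx (hx.trans hy.le) hy.le
    simp only at this
    linarith
  refine not_integrableOn_Ici_of_le (a := x + 1) (η := 2 * (u x * v x)) (by linarith)
    (f := fun x => u x ^ 2) (fun y hy => ?_) (hi.mono_set (Ici_subset_Ici.2 (by linarith)))
  have := hmono (self_mem_Ici) (show y ∈ Ici x by simp only [mem_Ici]; linarith) (by linarith)
  simp only at this
  nlinarith [sq_nonneg (u x)]

theorem antitoneOn_sq (h : IsSolutionOn q u v (Ici 0)) (ha : 0 ≤ a)
    (hn : ∀ x, a ≤ x → u x * v x ≤ 0) : AntitoneOn (fun x => u x ^ 2) (Ici a) := by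
  refine antitoneOn_Ici_of_hasDerivAt_nonpos
    ((h.continuousOn_fst.mono (Ici_subset_Ici.2 ha)).pow 2)
    (fun x hx => h.hasDerivAt_sq (ha.trans_lt hx)) fun x hx => ?_
  have := hn x hx.le
  linarith

/-- A decaying solution decays at least at the rate `k` given by a lower bound `k²` of the
coefficient: `v² - k² u²` is decreasing, and it cannot become negative without `u v` growing
linearly. -/
theorem sq_mul_sq_le_sq (h : IsSolutionOn q u v (Ici 0)) (ha : 0 ≤ a) {k : ℝ}
    (hq : ∀ x, a ≤ x → k ^ 2 ≤ q x) (hn : ∀ x, a ≤ x → u x * v x ≤ 0) {x : ℝ} (hx : a ≤ x) :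
    k ^ 2 * u x ^ 2 ≤ v x ^ 2 := by
  by_contra! hlt
  have hx0 : 0 ≤ x := ha.trans hx
  have hsub : Ici x ⊆ Ici (0 : ℝ) := Ici_subset_Ici.2 hx0
  set η := k ^ 2 * u x ^ 2 - v x ^ 2 with hη
  have hη0 : 0 < η := by linarith
  have hanti : AntitoneOn (fun y => v y ^ 2 - k ^ 2 * u y ^ 2) (Ici x) := by
    refine antitoneOn_Ici_of_hasDerivAt_nonpos
      (f' := fun y => 2 * (v y * (q y * u y)) - k ^ 2 * (2 * (u y * v y)))
      (((h.continuousOn_snd.mono hsub).pow 2).sub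
        (continuousOn_const.mul ((h.continuousOn_fst.mono hsub).pow 2)))
      (fun y hy => ?_) fun y hy => ?_
    · exact (((h.hasDerivAt_snd (hx0.trans_lt hy)).pow 2).sub
        ((h.hasDerivAt_sq (hx0.trans_lt hy)).const_mul _)).congr_deriv (by simp; ring)
    · have h1 := hn y (hx.trans hy.le)
      have h2 := hq y (hx.trans hy.le)
      nlinarith
  have hbig : ∀ y, x ≤ y → η ≤ k ^ 2 * u y ^ 2 := fun y hy => by
    have := hanti self_mem_Ici hy hy
    simp only at this
    nlinarith [sq_nonneg (v y)]
  have hmono : MonotoneOn (fun y => u y * v y - η * y) (Ici x) := by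
    refine monotoneOn_Ici_of_hasDerivAt_nonneg
      (f' := fun y => v y * v y + u y * (q y * u y) - η * 1)
      (((h.continuousOn_fst.mono hsub).mul (h.continuousOn_snd.mono hsub)).sub (by fun_prop))
      (fun y hy => ((h.hasDerivAt_fst (hx0.trans_lt hy)).mul
        (h.hasDerivAt_snd (hx0.trans_lt hy))).sub ((hasDerivAt_id y).const_mul _))
      fun y hy => ?_
    have h1 := hbig y hy.le
    have h2 := hq y (hx.trans hy.le)
    nlinarith [sq_nonneg (v y), mul_le_mul_of_nonneg_right h2 (sq_nonneg (u y))]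
  have hnx := hn x hx
  set y := x + (1 - u x * v x) / η with hy
  have hxy : x ≤ y := by
    have : 0 ≤ (1 - u x * v x) / η := div_nonneg (by linarith) hη0.le
    linarith
  have h1 := hmono self_mem_Ici hxy hxy
  have h2 : η * y = η * x + (1 - u x * v x) := by
    rw [hy]; field_simp
  have h3 := hn y (hx.trans hxy)
  simp only at h1
  linarith

theorem snd_le_of_pos (h : IsSolutionOn q u v (Ici 0)) (ha : 0 ≤ a) {k : ℝ}
    (hq : ∀ x, a ≤ x → k ^ 2 ≤ q x) (hn : ∀ x, a ≤ x → u x * v x ≤ 0)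
    (hpos : ∀ x, a ≤ x → 0 < u x) {x : ℝ} (hx : a ≤ x) : v x ≤ -(k * u x) := by
  have h1 := h.sq_mul_sq_le_sq ha hq hn hx
  have hv : v x ≤ 0 := by
    have := hn x hx
    have hp := hpos x hx
    by_contra! hc
    linarith [mul_pos hp hc]
  have h2 : |k * u x| ≤ -v x := abs_le_of_sq_le_sq (by nlinarith) (by linarith)
  linarith [le_abs_self (k * u x)]

theorem le_mul_exp_of_pos (h : IsSolutionOn q u v (Ici 0)) (ha : 0 ≤ a) {k : ℝ}
    (hq : ∀ x, a ≤ x → k ^ 2 ≤ q x) (hn : ∀ x, a ≤ x → u x * v x ≤ 0)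
    (hpos : ∀ x, a ≤ x → 0 < u x) {x : ℝ} (hx : a ≤ x) :
    u x ≤ u a * Real.exp (-(k * (x - a))) := by
  have hd (y : ℝ) : HasDerivAt (fun y => Real.exp (k * (y - a)))
      (Real.exp (k * (y - a)) * (k * 1)) y :=
    (((hasDerivAt_id y).sub_const a).const_mul k).exp
  have hanti : AntitoneOn (fun y => u y * Real.exp (k * (y - a))) (Ici a) := by
    refine antitoneOn_Ici_of_hasDerivAt_nonpos
      ((h.continuousOn_fst.mono (Ici_subset_Ici.2 ha)).mul
        (Continuous.continuousOn (by fun_prop)))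
      (fun y hy => (h.hasDerivAt_fst (ha.trans_lt hy)).mul (hd y)) fun y hy => ?_
    have := h.snd_le_of_pos ha hq hn hpos hy.le
    have he := Real.exp_pos (k * (y - a))
    nlinarith
  have := hanti self_mem_Ici hx hx
  simp only [sub_self, mul_zero, Real.exp_zero, mul_one] at this
  calc u x = u x * Real.exp (k * (x - a)) * Real.exp (-(k * (x - a))) := by
        rw [mul_assoc, ← Real.exp_add]; simp
    _ ≤ _ := by gcongr

theorem integral_sq_le_of_pos (h : IsSolutionOn q u v (Ici 0)) (ha : 0 ≤ a) {k : ℝ} (hk : 0 < k)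
    (hq : ∀ x, a ≤ x → k ^ 2 ≤ q x) (hn : ∀ x, a ≤ x → u x * v x ≤ 0)
    (hpos : ∀ x, a ≤ x → 0 < u x) :
    IntegrableOn (fun x => u x ^ 2) (Ioi a) ∧ ∫ x in Ioi a, u x ^ 2 ≤ u a ^ 2 * (1 / k) := by
  have hb : ∀ x ∈ Ioi a, u x ^ 2 ≤ u a ^ 2 * Real.exp (-(k * (x - a))) := fun x hx => by
    have h1 := h.le_mul_exp_of_pos ha hq hn hpos (le_of_lt hx)
    have h2 : u x ≤ u a := by
      refine h1.trans (mul_le_of_le_one_right (hpos a le_rfl).le (Real.exp_le_one_iff.2 ?_))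
      have : 0 ≤ k * (x - a) := mul_nonneg hk.le (sub_nonneg.2 (le_of_lt hx))
      linarith
    have h3 := hpos x (le_of_lt hx)
    calc u x ^ 2 = u x * u x := sq _
      _ ≤ u a * (u a * Real.exp (-(k * (x - a)))) :=
          mul_le_mul h2 h1 h3.le (hpos a le_rfl).le
      _ = _ := by ring
  have hI := (integrableOn_exp_neg_sub hk a a).const_mul (u a ^ 2)
  have hint : IntegrableOn (fun x => u x ^ 2) (Ioi a) := by
    refine Integrable.mono' hI ((((h.continuousOn_fst.mono (Ici_subset_Ici.2 ha)).mono
      Ioi_subset_Ici_self).pow 2).aestronglyMeasurable measurableSet_Ioi) ?_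
    filter_upwards [ae_restrict_mem measurableSet_Ioi] with x hx
    rw [Real.norm_eq_abs, abs_of_nonneg (sq_nonneg _)]
    exact hb x hx
  refine ⟨hint, ?_⟩
  rw [← integral_exp_neg_sub hk a, ← integral_const_mul]
  exact setIntegral_mono_on hint hI measurableSet_Ioi hb

/-- A decaying solution which vanishes somewhere in the forbidden region is zero. -/
theorem eq_zero_of_mul_nonpos (hqc : ContinuousOn q (Ici 0)) (h : IsSolutionOn q u v (Ici 0))
    (ha : 0 ≤ a) (hn : ∀ x, a ≤ x → u x * v x ≤ 0) {y : ℝ} (hy : a ≤ y) (hu : u y = 0) {x : ℝ}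
    (hx : 0 ≤ x) : u x = 0 ∧ v x = 0 := by
  have hz : ∀ z, y ≤ z → u z = 0 := fun z hz => by
    have := h.antitoneOn_sq ha hn hy (hy.trans hz) hz
    simp only [hu] at this
    nlinarith [sq_nonneg (u z)]
  have hy0 : 0 ≤ y := ha.trans hy
  have hv : v (y + 1) = 0 := by
    have h1 := h.hasDerivAt_fst (x := y + 1) (by linarith)
    have h2 : HasDerivAt u 0 (y + 1) := by
      refine (hasDerivAt_const (y + 1) (0 : ℝ)).congr_of_eventuallyEq ?_
      filter_upwards [Ioi_mem_nhds (show y < y + 1 by linarith)] with z hz'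
        using hz z (le_of_lt hz')
    exact h1.unique h2
  exact h.eq_zero hqc (y := y + 1) (by linarith) (hz _ (by linarith)) hv hx

theorem pos_of_ne_zero (h : IsSolutionOn q u v (Ici 0)) (ha : 0 ≤ a)
    (hne : ∀ x, a ≤ x → u x ≠ 0) (hua : 0 < u a) {x : ℝ} (hx : a ≤ x) : 0 < u x := by
  by_contra! hc
  obtain ⟨z, hz, hz0⟩ := intermediate_value_Icc' hx
    (h.continuousOn_fst.mono fun y hy => ha.trans hy.1) (show (0 : ℝ) ∈ Icc (u x) (u a) from
      ⟨hc, hua.le⟩)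
  exact hne z hz.1 hz0

end IsSolutionOn

/-- Existence of a decaying solution. Every pair `(cos t, sin t)` of Cauchy data at `0` gives a
solution; those with `u v ≤ 0` at `a + n` form a decreasing sequence of nonempty compact sets of
angles `t`, and any `t` in the intersection will do. -/
theorem exists_decaying_solution {q : ℝ → ℝ} (hqc : ContinuousOn q (Ici 0)) {a : ℝ} (ha : 0 ≤ a)
    (hq : ∀ x, a ≤ x → 0 ≤ q x) :
    ∃ u v, IsSolutionOn q u v (Ici 0) ∧ (∀ x, a ≤ x → u x * v x ≤ 0) ∧ ∀ x, a ≤ x → 0 < u x := by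
  obtain ⟨A, A', hA0, hA0', hA⟩ := exists_isSolutionOn_Ici hqc 1 0
  obtain ⟨B, B', hB0, hB0', hB⟩ := exists_isSolutionOn_Ici hqc 0 1
  let U : ℝ → ℝ → ℝ := fun t x => Real.cos t * A x + Real.sin t * B x
  let W : ℝ → ℝ → ℝ := fun t x => Real.cos t * A' x + Real.sin t * B' x
  have hs (t : ℝ) : IsSolutionOn q (U t) (W t) (Ici 0) := hA.linear_comb hB _ _
  have hmono (t : ℝ) := (hs t).monotoneOn_mul ha hq
  let S : ℕ → Set ℝ := fun n => Icc (-Real.pi) Real.pi ∩ {t | U t (a + n) * W t (a + n) ≤ 0}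
  have hclosed (n : ℕ) : IsClosed (S n) := by
    refine isClosed_Icc.inter (isClosed_le ?_ continuous_const)
    exact ((Real.continuous_cos.mul continuous_const).add
      (Real.continuous_sin.mul continuous_const)).mul
      ((Real.continuous_cos.mul continuous_const).add (Real.continuous_sin.mul continuous_const))
  obtain ⟨t, ht⟩ : (⋂ n, S n).Nonempty := by
    refine IsCompact.nonempty_iInter_of_sequence_nonempty_isCompact_isClosed S ?_ ?_ ?_ hclosed
    · rintro n t ⟨ht1, ht2⟩
      refine ⟨ht1, le_trans (hmono t ?_ ?_ ?_) ht2⟩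
      · have : (0 : ℝ) ≤ n := n.cast_nonneg
        simp only [mem_Ici]; linarith
      · have : (0 : ℝ) ≤ (n + 1 : ℕ) := Nat.cast_nonneg _
        simp only [mem_Ici]; linarith
      · push_cast; linarith
    · intro n
      -- a solution vanishing at `a + n` is `B(a + n) A - A(a + n) B`, up to a factor
      set z : ℂ := ⟨B (a + n), -A (a + n)⟩ with hz
      refine ⟨z.arg, ⟨(Complex.neg_pi_lt_arg z).le, Complex.arg_le_pi z⟩, ?_⟩
      have h1 := Complex.norm_mul_cos_arg z
      have h2 := Complex.norm_mul_sin_arg z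
      have hU : U z.arg (a + n) = 0 := by
        by_cases h0 : z = 0
        · have e1 : B (a + n) = 0 := congrArg Complex.re h0
          have e2 : -A (a + n) = 0 := congrArg Complex.im h0
          simp only [U]
          rw [e1, neg_eq_zero.1 e2]; ring
        · have : ‖z‖ * U z.arg (a + n) = 0 := by
            simp only [U]
            rw [mul_add, ← mul_assoc, ← mul_assoc, h1, h2, hz]
            simp only
            ring
          exact (mul_eq_zero.1 this).resolve_left (norm_ne_zero_iff.2 h0)
      change U z.arg (a + n) * _ ≤ 0
      rw [hU, zero_mul]
    · exact isCompact_Icc.inter_right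
        (by simpa [S] using (isClosed_le (by fun_prop) continuous_const))
  rw [mem_iInter] at ht
  have hn : ∀ x, a ≤ x → U t x * W t x ≤ 0 := fun x hx => by
    obtain ⟨n, hnx⟩ := exists_nat_ge (x - a)
    exact le_trans (hmono t hx (show a ≤ a + (n : ℝ) by linarith) (by linarith)) (ht n).2
  have hne : ∀ x, a ≤ x → U t x ≠ 0 := fun x hx h0 => by
    have := (hs t).eq_zero_of_mul_nonpos hqc ha hn hx h0 (x := 0) le_rfl
    simp only [U, W, hA0, hB0, hA0', hB0'] at this
    have h1 := Real.sin_sq_add_cos_sq t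
    rw [show Real.cos t = 0 by linarith [this.1], show Real.sin t = 0 by linarith [this.2]] at h1
    norm_num at h1
  rcases lt_or_gt_of_ne (hne a le_rfl) with h | h
  · have hs' := (hs t).const_mul (-1)
    refine ⟨_, _, hs', fun x hx => ?_, fun x hx => ?_⟩
    · have := hn x hx
      linarith
    · exact hs'.pos_of_ne_zero ha (fun y hy => by simpa using hne y hy) (by linarith) hx
  · exact ⟨_, _, hs t, hn, fun x hx => (hs t).pos_of_ne_zero ha hne h hx⟩

/-! ### Classical solutions as solutions of the first-order system -/

theorem IsHalfLineSolution.isSolutionOn {V : ℝ → ℝ} {h E : ℝ} {u : ℝ → ℝ} (hh : 0 < h)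
    (hu : IsHalfLineSolution V h E u) :
    IsSolutionOn (fun x => (V x - E) / h ^ 2) u (derivWithin u (Ici 0)) (Ici 0) := by
  have hc := hu.contDiffOn
  rw [← one_add_one_eq_two, contDiffOn_succ_iff_derivWithin (uniqueDiffOn_Ici 0)] at hc
  refine ⟨fun x hx => (hc.1 x hx).hasDerivWithinAt, fun x hx => ?_⟩
  refine ((hc.2.2.differentiableOn one_ne_zero) x hx).hasDerivWithinAt.congr_deriv ?_
  have := hu.eqn x hx
  field_simp
  linarith

theorem IsSolutionOn.isHalfLineSolution {V : ℝ → ℝ} {h E : ℝ} {u v : ℝ → ℝ} (hh : 0 < h)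
    (hV : ContinuousOn V (Ici 0))
    (hu : IsSolutionOn (fun x => (V x - E) / h ^ 2) u v (Ici 0)) :
    IsHalfLineSolution V h E u ∧ EqOn (derivWithin u (Ici 0)) v (Ici 0) := by
  have h1 : EqOn (derivWithin u (Ici 0)) v (Ici 0) := fun x hx =>
    (hu.deriv_fst x hx).derivWithin (uniqueDiffOn_Ici 0 x hx)
  have h2 : ∀ x ∈ Ici (0 : ℝ),
      HasDerivWithinAt (derivWithin u (Ici 0)) ((V x - E) / h ^ 2 * u x) (Ici 0) x :=
    fun x hx => (hu.deriv_snd x hx).congr h1 (h1 hx)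
  have h3 : ∀ x ∈ Ici (0 : ℝ),
      derivWithin (derivWithin u (Ici 0)) (Ici 0) x = (V x - E) / h ^ 2 * u x :=
    fun x hx => (h2 x hx).derivWithin (uniqueDiffOn_Ici 0 x hx)
  refine ⟨⟨?_, fun x hx => ?_⟩, h1⟩
  · rw [← one_add_one_eq_two, contDiffOn_succ_iff_derivWithin (uniqueDiffOn_Ici 0),
      contDiffOn_one_iff_derivWithin (uniqueDiffOn_Ici 0)]
    refine ⟨fun x hx => (hu.deriv_fst x hx).differentiableWithinAt, by simp,
      fun x hx => (h2 x hx).differentiableWithinAt, ?_⟩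
    exact ContinuousOn.congr (((hV.sub continuousOn_const).div_const _).mul hu.continuousOn_fst) h3
  · rw [h3 x hx]
    field_simp
    ring

/-! ### The normalized solution and the lower bound on its Cauchy datum -/

/-- The exponential decay rate `√(V(d) - E) / h` guaranteed on `[d, ∞)`. -/
noncomputable def decayRate (V : ℝ → ℝ) (d h E : ℝ) : ℝ := Real.sqrt (V d - E) / h

section decayRate

variable {V : ℝ → ℝ} {d h E : ℝ}

theorem decayRate_pos (hh : 0 < h) (hE : E < V d) : 0 < decayRate V d h E :=
  div_pos (Real.sqrt_pos.2 (sub_pos.2 hE)) hh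

theorem decayRate_sq_le (hE : E < V d) (hV : ∀ x, d ≤ x → V d ≤ V x) {x : ℝ} (hx : d ≤ x) :
    decayRate V d h E ^ 2 ≤ (V x - E) / h ^ 2 := by
  rw [decayRate, div_pow, Real.sq_sqrt (sub_pos.2 hE).le]
  have := hV x hx
  gcongr

theorem coeff_nonneg (hE : E < V d) (hV : ∀ x, d ≤ x → V d ≤ V x) {x : ℝ} (hx : d ≤ x) :
    0 ≤ (V x - E) / h ^ 2 :=
  (sq_nonneg _).trans (decayRate_sq_le hE hV hx)

theorem coeff_continuousOn (hVc : ContinuousOn V (Ici 0)) :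
    ContinuousOn (fun x => (V x - E) / h ^ 2) (Ici 0) :=
  (hVc.sub continuousOn_const).div_const _

end decayRate

theorem exists_isNormalizedSolution {V : ℝ → ℝ} {d h E : ℝ} (hd : 0 ≤ d) (hh : 0 < h)
    (hVc : ContinuousOn V (Ici 0)) (hV : ∀ x, d ≤ x → V d ≤ V x) (hE : E < V d) :
    ∃ G, IsNormalizedSolution V d h E G := by
  obtain ⟨u, v, hs, hn, hpos⟩ := exists_decaying_solution (coeff_continuousOn (E := E) (h := h) hVc)
    hd fun x hx => coeff_nonneg hE hV hx
  have hint := (hs.integral_sq_le_of_pos hd (decayRate_pos hh hE)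
    (fun x hx => decayRate_sq_le hE hV hx) hn hpos).1
  have hI : IntegrableOn (fun x => u x ^ 2) (Ici 0) :=
    integrableOn_Ici_of_continuousOn (hs.continuousOn_fst.pow 2) hint
  set N := ∫ x in Ici 0, u x ^ 2 with hN
  have hN0 : 0 < N := by
    refine (setIntegral_pos_iff_support_of_nonneg_ae
      (Filter.Eventually.of_forall fun x => sq_nonneg (u x)) hI).2 ?_
    refine lt_of_lt_of_le (b := volume (Ici d)) (by simp) (measure_mono fun x hx => ?_)
    exact ⟨by simpa using (hpos x hx).ne', hd.trans hx⟩
  have hsq : ∀ x, ((Real.sqrt N)⁻¹ * u x) ^ 2 = N⁻¹ * u x ^ 2 := fun x => by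
    rw [mul_pow, inv_pow, Real.sq_sqrt hN0.le]
  refine ⟨fun x => (Real.sqrt N)⁻¹ * u x,
    ((hs.const_mul (Real.sqrt N)⁻¹).isHalfLineSolution hh hVc).1, ?_, ?_, fun x hx =>
      mul_pos (inv_pos.2 (Real.sqrt_pos.2 hN0)) (hpos x hx)⟩
  · simp_rw [hsq]
    exact hI.const_mul _
  · simp_rw [hsq]
    rw [integral_const_mul, ← hN, inv_mul_cancel₀ hN0.ne']

/-- Two `L²` solutions are proportional: a linear combination vanishing at `d` is an `L²` solution
which vanishes in the forbidden region. -/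
theorem IsHalfLineSolution.eqOn_mul {V : ℝ → ℝ} {d h E : ℝ} {u G : ℝ → ℝ} (hd : 0 ≤ d) (hh : 0 < h)
    (hVc : ContinuousOn V (Ici 0)) (hV : ∀ x, d ≤ x → V d ≤ V x) (hE : E < V d)
    (hu : IsHalfLineSolution V h E u) (hui : IntegrableOn (fun x => u x ^ 2) (Ici 0))
    (hG : IsNormalizedSolution V d h E G) {x : ℝ} (hx : 0 ≤ x) :
    u x = u d / G d * G x ∧
      derivWithin u (Ici 0) x = u d / G d * derivWithin G (Ici 0) x := by
  have h1 := hu.isSolutionOn hh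
  have h2 := hG.solution.isSolutionOn hh
  have hr := h1.linear_comb h2 1 (-(u d / G d))
  have hri : IntegrableOn (fun x => (1 * u x + -(u d / G d) * G x) ^ 2) (Ici 0) := by
    refine Integrable.mono' ((hui.const_mul 2).add (hG.integrable.const_mul (2 * (u d / G d) ^ 2)))
      ((hr.continuousOn_fst.pow 2).aestronglyMeasurable measurableSet_Ici) ?_
    refine Filter.Eventually.of_forall fun x => ?_
    rw [Real.norm_eq_abs, abs_of_nonneg (sq_nonneg _)]
    simp only [Pi.add_apply]
    nlinarith [sq_nonneg (u x + (u d / G d) * G x)]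
  have hGd : G d ≠ 0 := (hG.pos d le_rfl).ne'
  have := hr.eq_zero_of_mul_nonpos (coeff_continuousOn hVc) hd
    (fun x hx => hr.mul_nonpos_of_integrableOn hd (fun x hx => coeff_nonneg hE hV hx) hri hx)
    (le_refl d) (by field_simp; ring) hx
  constructor <;> linarith [this.1, this.2]

theorem IsNormalizedSolution.eqOn {V : ℝ → ℝ} {d h E : ℝ} {G₁ G₂ : ℝ → ℝ} (hd : 0 ≤ d) (hh : 0 < h)
    (hVc : ContinuousOn V (Ici 0)) (hV : ∀ x, d ≤ x → V d ≤ V x) (hE : E < V d)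
    (h₁ : IsNormalizedSolution V d h E G₁) (h₂ : IsNormalizedSolution V d h E G₂) :
    EqOn G₁ G₂ (Ici 0) := by
  set t := G₁ d / G₂ d
  have hp : ∀ x ∈ Ici (0 : ℝ), G₁ x = t * G₂ x := fun x hx =>
    (h₁.solution.eqOn_mul hd hh hVc hV hE h₁.integrable h₂ hx).1
  have ht : 0 < t := div_pos (h₁.pos d le_rfl) (h₂.pos d le_rfl)
  have h3 : ∫ x in Ici 0, G₁ x ^ 2 = t ^ 2 * ∫ x in Ici 0, G₂ x ^ 2 := by
    rw [← integral_const_mul]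
    exact setIntegral_congr_fun measurableSet_Ici fun x hx => by simp only [hp x hx]; ring
  rw [h₁.normalized, h₂.normalized, mul_one] at h3
  have ht1 : t = 1 := by nlinarith
  exact fun x hx => by rw [hp x hx, ht1, one_mul]

theorem norm_cauchyDatum_sq (h : ℝ) (G : ℝ → ℝ) :
    ‖cauchyDatum h G‖ ^ 2 = G 0 ^ 2 + h ^ 2 * derivWithin G (Ici 0) 0 ^ 2 := by
  rw [← Complex.normSq_eq_norm_sq, Complex.normSq_apply]
  simp [cauchyDatum]
  ring

/-- The lower bound on the Cauchy datum, with explicit constants. The energy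
`h² G'² + (E - V) G²` has derivative `-V' G²`, hence is decreasing on `[0, d]`; at `0` it is
controlled by the Cauchy datum, and at `d` it is nonnegative because `G` decays at least at the rate
`√(V(d) - E) / h`. It bounds `G²` pointwise on `[0, b]`, and its total variation bounds `∫ G²` on
`[b, d]`. The mass beyond `d` is dominated by the mass on `[c, d]`, where `G²` decreases. -/
theorem one_le_mul_norm_cauchyDatum_sq {V : ℝ → ℝ} {b c d δ m M h E : ℝ} {G : ℝ → ℝ} (hb : 0 < b)
    (hbc : b < c) (hcd : c < d) (hVc : ContinuousOn V (Ici 0)) (hV0 : V 0 = 0)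
    (hV : ∀ x, d ≤ x → V d ≤ V x) (hV' : ∀ x ∈ Ioc 0 d, 0 < deriv V x)
    (hδ : 0 < δ) (hm : 0 < m) (hm' : ∀ x ∈ Icc b d, m ≤ deriv V x) (hEM : E ≤ M)
    (hEb : V b + δ ≤ E) (hEc : E + δ ≤ V c) (hh : 0 < h) (hh1 : h ≤ 1)
    (hG : IsNormalizedSolution V d h E G) :
    1 ≤ (b / δ + 1 / m + 1 / (Real.sqrt δ * (d - c)) * (1 / m)) * max 1 M *
      ‖cauchyDatum h G‖ ^ 2 := by
  have hd : 0 < d := by linarith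
  have hc : 0 < c := by linarith
  have hs := hG.solution.isSolutionOn hh
  set v := derivWithin G (Ici 0) with hv
  have hVd : ∀ x ∈ Ioc 0 d, HasDerivAt V (deriv V x) x := fun x hx =>
    (differentiableAt_of_deriv_ne_zero (hV' x hx).ne').hasDerivAt
  have hmonoV : StrictMonoOn V (Icc 0 d) :=
    strictMonoOn_of_deriv_pos (convex_Icc 0 d) (hVc.mono Icc_subset_Ici_self) fun x hx => by
      rw [interior_Icc] at hx
      exact hV' x ⟨hx.1, hx.2.le⟩
  have hVcd : ∀ x, c ≤ x → V c ≤ V x := fun x hx => by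
    rcases le_total x d with h' | h'
    · exact hmonoV.monotoneOn ⟨hc.le, hcd.le⟩ ⟨hc.le.trans hx, h'⟩ hx
    · exact (hmonoV.monotoneOn ⟨hc.le, hcd.le⟩ ⟨hd.le, le_rfl⟩ hcd.le).trans (hV x h')
  have hEd : E + δ ≤ V d := hEc.trans (hVcd d hcd.le)
  have hEd' : E < V d := by linarith
  have hn : ∀ x, c ≤ x → G x * v x ≤ 0 := fun x hx =>
    hs.mul_nonpos_of_integrableOn hc.le
      (fun y hy => coeff_nonneg (d := c) (by linarith) hVcd hy) hG.integrable hx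
  have hnd : ∀ x, d ≤ x → G x * v x ≤ 0 := fun x hx => hn x (hcd.le.trans hx)
  have hqd : ∀ x, d ≤ x → decayRate V d h E ^ 2 ≤ (V x - E) / h ^ 2 :=
    fun x hx => decayRate_sq_le hEd' hV hx
  have hcG : ContinuousOn (fun x => G x ^ 2) (Ici 0) := hs.continuousOn_fst.pow 2
  let g : ℝ → ℝ := fun x => G (max x 0) ^ 2
  have hg : Continuous g := by
    have : Continuous fun x : ℝ => G (max x 0) :=
      hs.continuousOn_fst.comp_continuous (by fun_prop) fun x => le_max_right x 0
    exact this.pow 2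
  have hgG : ∀ x, 0 ≤ x → g x = G x ^ 2 := fun x hx => by simp only [g, max_eq_left hx]
  -- the energy
  let F : ℝ → ℝ := fun x => h ^ 2 * v x ^ 2 + (E - V x) * G x ^ 2
  have hFc : ContinuousOn F (Icc 0 d) := by
    refine ContinuousOn.mono (s := Ici 0) ?_ Icc_subset_Ici_self
    exact (continuousOn_const.mul (hs.continuousOn_snd.pow 2)).add
      ((continuousOn_const.sub hVc).mul hcG)
  have hFd : ∀ x ∈ Ioo 0 d, HasDerivAt F (-(deriv V x * G x ^ 2)) x := fun x hx => by
    have h1 := ((hs.hasDerivAt_snd hx.1).pow 2).const_mul (h ^ 2)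
    have h2 := ((hVd x ⟨hx.1, hx.2.le⟩).const_sub E).mul (hs.hasDerivAt_sq hx.1)
    refine (h1.add h2).congr_deriv ?_
    simp only [Nat.cast_ofNat, Nat.add_one_sub_one, pow_one]
    field_simp
    ring
  have hFanti : AntitoneOn F (Icc 0 d) := by
    refine antitoneOn_of_hasDerivWithinAt_nonpos (f' := fun x => -(deriv V x * G x ^ 2))
      (convex_Icc 0 d) hFc ?_ ?_ <;> rw [interior_Icc] <;> intro x hx
    · exact (hFd x hx).hasDerivWithinAt
    · have := hV' x ⟨hx.1, hx.2.le⟩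
      simp only [Left.neg_nonpos_iff]
      positivity
  have hFend : 0 ≤ F d := by
    have := hs.sq_mul_sq_le_sq hd.le hqd hnd le_rfl
    rw [decayRate, div_pow, Real.sq_sqrt (by linarith), div_mul_eq_mul_div,
      div_le_iff₀ (by positivity)] at this
    simp only [F]
    linarith
  have hF0 : F 0 ≤ max 1 M * ‖cauchyDatum h G‖ ^ 2 := by
    rw [norm_cauchyDatum_sq]
    simp only [F, hV0, sub_zero]
    have h1 : E ≤ max 1 M := hEM.trans (le_max_right _ _)
    have h2 : (1 : ℝ) ≤ max 1 M := le_max_left _ _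
    have h3 : 0 ≤ h ^ 2 * v 0 ^ 2 := by positivity
    have h4 : 0 ≤ G 0 ^ 2 := by positivity
    nlinarith
  have hF0' : 0 ≤ F 0 := hFend.trans (hFanti ⟨le_rfl, hd.le⟩ ⟨hd.le, le_rfl⟩ hd.le)
  -- the mass on `[0, b]`
  have hI1 : ∫ x in (0)..b, g x ≤ b / δ * F 0 := by
    have : ∫ x in (0)..b, g x ≤ ∫ _ in (0)..b, F 0 / δ := by
      refine intervalIntegral.integral_mono_on hb.le (hg.intervalIntegrable _ _)
        intervalIntegrable_const fun x hx => ?_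
      rw [hgG x hx.1, le_div_iff₀ hδ]
      have hx' : x ∈ Icc 0 d := ⟨hx.1, by linarith [hx.2]⟩
      have h1 : F x ≤ F 0 := hFanti ⟨le_rfl, hd.le⟩ hx' hx.1
      have h2 : V x ≤ V b := hmonoV.monotoneOn hx' ⟨hb.le, by linarith⟩ hx.2
      have h3 : δ * G x ^ 2 ≤ (E - V x) * G x ^ 2 := by
        gcongr; linarith
      have h4 : 0 ≤ h ^ 2 * v x ^ 2 := by positivity
      simp only [F] at h1 ⊢
      linarith
    refine this.trans (le_of_eq ?_)
    rw [intervalIntegral.integral_const, smul_eq_mul]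
    ring
  -- the mass on `[b, d]`
  have hI2 : ∫ x in b..d, g x ≤ 1 / m * F 0 := by
    have hanti : AntitoneOn (fun x => F x + m * ∫ t in b..x, g t) (Icc b d) := by
      refine antitoneOn_of_hasDerivWithinAt_nonpos
        (f' := fun x => -(deriv V x * G x ^ 2) + m * g x) (convex_Icc b d) ?_ ?_ ?_
      · exact (hFc.mono (Icc_subset_Icc_left hb.le)).add (continuousOn_const.mul
          (Differentiable.continuous fun x =>
            (hg.integral_hasStrictDerivAt b x).hasDerivAt.differentiableAt).continuousOn)
      · rw [interior_Icc]
        intro x hx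
        exact ((hFd x ⟨hb.trans hx.1, hx.2⟩).add
          ((hg.integral_hasStrictDerivAt b x).hasDerivAt.const_mul m)).hasDerivWithinAt
      · rw [interior_Icc]
        intro x hx
        have h1 := hm' x ⟨hx.1.le, hx.2.le⟩
        rw [hgG x (hb.trans hx.1).le]
        nlinarith [mul_le_mul_of_nonneg_right h1 (sq_nonneg (G x))]
    have h1 := hanti (left_mem_Icc.2 (by linarith)) (right_mem_Icc.2 (by linarith))
      (show b ≤ d by linarith)
    simp only [intervalIntegral.integral_same, mul_zero, add_zero] at h1
    have h2 : F b ≤ F 0 := hFanti ⟨le_rfl, hd.le⟩ ⟨hb.le, by linarith⟩ hb.le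
    rw [div_mul_eq_mul_div, one_mul, le_div_iff₀ hm]
    linarith
  -- the mass beyond `d`
  have hI3 : ∫ x in Ioi d, G x ^ 2 ≤ 1 / (Real.sqrt δ * (d - c)) * ∫ x in b..d, g x := by
    have h1 := (hs.integral_sq_le_of_pos hd.le (decayRate_pos hh hEd') hqd hnd hG.pos).2
    have h2 : 1 / decayRate V d h E ≤ 1 / Real.sqrt δ := by
      have hsδ : 0 < Real.sqrt δ := Real.sqrt_pos.2 hδ
      refine one_div_le_one_div_of_le hsδ ?_
      rw [decayRate, le_div_iff₀ hh]
      have : Real.sqrt δ ≤ Real.sqrt (V d - E) := Real.sqrt_le_sqrt (by linarith)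
      nlinarith
    have h3 : (d - c) * G d ^ 2 ≤ ∫ x in c..d, g x := by
      have : ∫ _ in c..d, G d ^ 2 ≤ ∫ x in c..d, g x := by
        refine intervalIntegral.integral_mono_on hcd.le intervalIntegrable_const
          (hg.intervalIntegrable _ _) fun x hx => ?_
        rw [hgG x (hc.le.trans hx.1)]
        exact hs.antitoneOn_sq hc.le hn hx.1 hcd.le hx.2
      rwa [intervalIntegral.integral_const, smul_eq_mul] at this
    have h4 : ∫ x in c..d, g x ≤ ∫ x in b..d, g x := by
      rw [← intervalIntegral.integral_add_adjacent_intervals (hg.intervalIntegrable b c)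
        (hg.intervalIntegrable c d)]
      have : 0 ≤ ∫ x in b..c, g x :=
        intervalIntegral.integral_nonneg hbc.le fun x _ => sq_nonneg _
      linarith
    have hdc : 0 < d - c := by linarith
    calc ∫ x in Ioi d, G x ^ 2 ≤ G d ^ 2 * (1 / decayRate V d h E) := h1
      _ ≤ ((∫ x in b..d, g x) / (d - c)) * (1 / Real.sqrt δ) := by
          refine mul_le_mul ?_ h2 (one_div_nonneg.2 (decayRate_pos hh hEd').le) ?_
          · rw [le_div_iff₀ hdc]; linarith
          · exact div_nonneg ((mul_nonneg hdc.le (sq_nonneg _)).trans (h3.trans h4)) hdc.le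
      _ = _ := by
          have hsδ : 0 < Real.sqrt δ := Real.sqrt_pos.2 hδ
          field_simp
  have hsplit : (1 : ℝ) = (∫ x in (0)..b, g x) + (∫ x in b..d, g x) + ∫ x in Ioi d, G x ^ 2 := by
    rw [intervalIntegral.integral_add_adjacent_intervals (hg.intervalIntegrable _ _)
      (hg.intervalIntegrable _ _), ← hG.normalized, integral_Ici_eq_integral_Ioi,
      ← intervalIntegral.integral_interval_add_Ioi (b := d)
        (hG.integrable.mono_set Ioi_subset_Ici_self)
        (hG.integrable.mono_set fun x hx => hd.le.trans (le_of_lt hx))]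
    congr 1
    refine intervalIntegral.integral_congr fun x hx => ?_
    rw [uIcc_of_le hd.le] at hx
    exact (hgG x hx.1).symm
  have hdc : 0 < d - c := by linarith
  have hsδ : 0 < Real.sqrt δ := Real.sqrt_pos.2 hδ
  set κ := 1 / (Real.sqrt δ * (d - c)) with hκ
  have hκ0 : 0 ≤ κ := by positivity
  calc (1 : ℝ) ≤ b / δ * F 0 + 1 / m * F 0 + κ * (1 / m * F 0) := by
        have := mul_le_mul_of_nonneg_left hI2 hκ0
        linarith
    _ = (b / δ + 1 / m + κ * (1 / m)) * F 0 := by ring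
    _ ≤ (b / δ + 1 / m + κ * (1 / m)) * (max 1 M * ‖cauchyDatum h G‖ ^ 2) := by gcongr
    _ = _ := by ring

/-! ### Compactness of the class of potentials -/

namespace SmoothIcc

variable {d : ℝ}

theorem continuous_jet (n : ℕ) : Continuous fun w : SmoothIcc d => w.jet n :=
  have h : Continuous (SmoothIcc.jet (d := d)) := continuous_induced_dom
  (continuous_apply n).comp h

theorem continuous_jet_apply (hd : 0 < d) (n : ℕ) :
    Continuous fun p : SmoothIcc d × Icc (0 : ℝ) d => UniformFun.toFun (p.1.jet n) p.2 := by
  refine continuous_iff_continuousAt.2 fun ⟨w, x⟩ => ?_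
  have h1 : TendstoUniformly (fun (p : SmoothIcc d × Icc (0 : ℝ) d) =>
      UniformFun.toFun (p.1.jet n)) (UniformFun.toFun (w.jet n)) (𝓝 (w, x)) :=
    UniformFun.tendsto_iff_tendstoUniformly.1
      (((continuous_jet n).comp continuous_fst).tendsto (w, x))
  have h2 : Continuous (UniformFun.toFun (w.jet n)) :=
    continuousOn_iff_continuous_domRestrict.1
      (w.smooth.continuousOn_iteratedDerivWithin (by exact_mod_cast le_top) (uniqueDiffOn_Icc hd))
  exact h1.tendsto_comp h2.continuousAt (continuous_snd.tendsto (w, x))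

theorem jet_zero_apply (w : SmoothIcc d) (x : Icc (0 : ℝ) d) :
    UniformFun.toFun (w.jet 0) x = w.toFun x := by
  simp [jet]

theorem hasDerivWithinAt_extend (w : SmoothIcc d) (x : Icc (0 : ℝ) d) :
    HasDerivWithinAt (Function.extend Subtype.val w.toFun 0) (UniformFun.toFun (w.jet 1) x)
      (Icc 0 d) x := by
  have := ((w.smooth.differentiableOn (by simp)) x x.2).hasDerivWithinAt
  simpa [jet, iteratedDerivWithin_one] using this

end SmoothIcc

namespace IsWellPotential

variable {γ d : ℝ} {V W : ℝ → ℝ}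

theorem eqOn_extend (hγ : 0 < γ) (hV : IsWellPotential γ d V W) {w : SmoothIcc d}
    (hw : w.IsRestrictionOf W) {x : ℝ} (hx : x ∈ Icc 0 d) :
    V x = x ^ γ * Function.extend Subtype.val w.toFun 0 x := by
  rcases hx.1.eq_or_lt with h | h
  · rw [← h, hV.zero, Real.zero_rpow hγ.ne', zero_mul]
  · have := Subtype.val_injective.extend_apply w.toFun 0 ⟨x, hx⟩
    rw [hV.eq_mul x h, this, hw ⟨x, hx⟩]

theorem apply_eq (hγ : 0 < γ) (hV : IsWellPotential γ d V W) {w : SmoothIcc d}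
    (hw : w.IsRestrictionOf W) (x : Icc (0 : ℝ) d) :
    V x = (x : ℝ) ^ γ * UniformFun.toFun (w.jet 0) x := by
  rw [hV.eqOn_extend hγ hw x.2, w.jet_zero_apply, Subtype.val_injective.extend_apply]

theorem hasDerivAt (hV : IsWellPotential γ d V W) {x : ℝ} (hx : x ∈ Ioc 0 d) :
    HasDerivAt V (deriv V x) x :=
  (differentiableAt_of_deriv_ne_zero (hV.deriv_pos x hx).ne').hasDerivAt

theorem deriv_eq (hγ : 0 < γ) (hV : IsWellPotential γ d V W) {w : SmoothIcc d}
    (hw : w.IsRestrictionOf W) (x : Icc (0 : ℝ) d) (hx : 0 < (x : ℝ)) :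
    deriv V x = γ * (x : ℝ) ^ (γ - 1) * UniformFun.toFun (w.jet 0) x +
      (x : ℝ) ^ γ * UniformFun.toFun (w.jet 1) x := by
  have hd : 0 < d := hx.trans_le x.2.2
  have h1 : HasDerivWithinAt V (deriv V x) (Icc 0 d) x :=
    (hV.hasDerivAt ⟨hx, x.2.2⟩).hasDerivWithinAt
  have h2 := ((Real.hasDerivAt_rpow_const (p := γ) (Or.inl hx.ne')).hasDerivWithinAt
    (s := Icc 0 d)).mul (w.hasDerivWithinAt_extend x)
  have h3 := h2.congr (f₁ := V) (fun y hy => hV.eqOn_extend hγ hw hy) (hV.eqOn_extend hγ hw x.2)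
  rw [(uniqueDiffOn_Icc hd x x.2).eq_deriv _ h1 h3, w.jet_zero_apply,
    Subtype.val_injective.extend_apply]

theorem strictMonoOn (hV : IsWellPotential γ d V W) : StrictMonoOn V (Icc 0 d) :=
  strictMonoOn_of_deriv_pos (convex_Icc 0 d) (hV.continuousOn.mono Icc_subset_Ici_self)
    fun x hx => by
      rw [interior_Icc] at hx
      exact hV.deriv_pos x ⟨hx.1, hx.2.le⟩

end IsWellPotential

theorem IsCompact.exists_pos_forall_le {X : Type*} [TopologicalSpace X] {s : Set X}
    (hs : IsCompact s) {f : X → ℝ} (hf : ContinuousOn f s) (hpos : ∀ x ∈ s, 0 < f x) :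
    ∃ δ, 0 < δ ∧ ∀ x ∈ s, δ ≤ f x := by
  rcases s.eq_empty_or_nonempty with rfl | hne
  · exact ⟨1, one_pos, by simp⟩
  · obtain ⟨x, hx, hmin⟩ := hs.exists_isMinOn hne hf
    exact ⟨f x, hpos x hx, fun y hy => hmin hy⟩

/-- The class of potentials is compact, so that its defining strict inequalities hold with uniform
margins. -/
theorem exists_uniform_margins {γ b c d : ℝ} (hγ : 0 < γ) (hb : 0 < b) (hbc : b < c) (hcd : c < d)
    {𝒦 : Set (SmoothIcc d)} (h𝒦 : IsCompact 𝒦) {K : Set ℝ} (hK : IsCompact K)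
    (hfull : ∀ w ∈ 𝒦, ∃ V ∈ potentialClass γ b c d 𝒦 K,
      ∃ W, IsWellPotential γ d V W ∧ w.IsRestrictionOf W) :
    ∃ δ m : ℝ, 0 < δ ∧ 0 < m ∧ ∀ V ∈ potentialClass γ b c d 𝒦 K,
      (∀ E ∈ K, V b + δ ≤ E ∧ E + δ ≤ V c) ∧ ∀ x ∈ Icc b d, m ≤ deriv V x := by
  have hd : 0 < d := by linarith
  let xb : Icc (0 : ℝ) d := ⟨b, hb.le, by linarith⟩
  let xc : Icc (0 : ℝ) d := ⟨c, by linarith, hcd.le⟩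
  have hev (n : ℕ) (x : Icc (0 : ℝ) d) :
      Continuous fun p : SmoothIcc d × ℝ => UniformFun.toFun (p.1.jet n) x :=
    (SmoothIcc.continuous_jet_apply hd n).comp (continuous_fst.prodMk continuous_const)
  obtain ⟨δ₁, hδ₁, h1⟩ := (h𝒦.prod hK).exists_pos_forall_le
    (f := fun p => p.2 - b ^ γ * UniformFun.toFun (p.1.jet 0) xb)
    (continuous_snd.sub (continuous_const.mul (hev 0 xb))).continuousOn (by
      rintro ⟨w, E⟩ ⟨hw, hE⟩
      obtain ⟨V, ⟨_, _, _, hVb, _⟩, W, hVW, hwW⟩ := hfull w hw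
      have := hVb E hE b ⟨hb.le, le_rfl⟩
      rwa [hVW.apply_eq hγ hwW xb] at this)
  obtain ⟨δ₂, hδ₂, h2⟩ := (h𝒦.prod hK).exists_pos_forall_le
    (f := fun p => c ^ γ * UniformFun.toFun (p.1.jet 0) xc - p.2)
    ((continuous_const.mul (hev 0 xc)).sub continuous_snd).continuousOn (by
      rintro ⟨w, E⟩ ⟨hw, hE⟩
      obtain ⟨V, ⟨_, _, _, _, hVc⟩, W, hVW, hwW⟩ := hfull w hw
      have := hVc E hE c ⟨le_rfl, hcd.le⟩
      rwa [hVW.apply_eq hγ hwW xc] at this)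
  have hcl : IsCompact {x : Icc (0 : ℝ) d | b ≤ x} :=
    (isClosed_le continuous_const continuous_subtype_val).isCompact
  obtain ⟨m, hm, h3⟩ := (h𝒦.prod hcl).exists_pos_forall_le
    (f := fun p => γ * (p.2 : ℝ) ^ (γ - 1) * UniformFun.toFun (p.1.jet 0) p.2 +
      (p.2 : ℝ) ^ γ * UniformFun.toFun (p.1.jet 1) p.2)
    (by
      have hp (r : ℝ) : ContinuousOn (fun p : SmoothIcc d × Icc (0 : ℝ) d => (p.2 : ℝ) ^ r)
          (𝒦 ×ˢ {x : Icc (0 : ℝ) d | b ≤ x}) :=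
        ContinuousOn.rpow_const (by fun_prop) fun p hp => Or.inl (hb.trans_le hp.2).ne'
      exact ((continuousOn_const.mul (hp _)).mul
        (SmoothIcc.continuous_jet_apply hd 0).continuousOn).add
        ((hp _).mul (SmoothIcc.continuous_jet_apply hd 1).continuousOn))
    (by
      rintro ⟨w, x⟩ ⟨hw, hx⟩
      obtain ⟨V, _, W, hVW, hwW⟩ := hfull w hw
      have hx0 : 0 < (x : ℝ) := hb.trans_le hx
      have := hVW.deriv_pos x ⟨hx0, x.2.2⟩
      rwa [hVW.deriv_eq hγ hwW x hx0] at this)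
  refine ⟨min δ₁ δ₂, m, lt_min hδ₁ hδ₂, hm, ?_⟩
  rintro V ⟨W, hVW, ⟨w, hw, hwW⟩, _, _⟩
  refine ⟨fun E hE => ⟨?_, ?_⟩, fun x hx => ?_⟩
  · have h := h1 (w, E) ⟨hw, hE⟩
    have e := hVW.apply_eq hγ hwW xb
    simp only [xb] at h e
    linarith [min_le_left δ₁ δ₂]
  · have h := h2 (w, E) ⟨hw, hE⟩
    have e := hVW.apply_eq hγ hwW xc
    simp only [xc] at h e
    linarith [min_le_right δ₁ δ₂]
  · have h := h3 (w, ⟨x, hb.le.trans hx.1, hx.2⟩) ⟨hw, hx.1⟩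
    rwa [← hVW.deriv_eq hγ hwW ⟨x, hb.le.trans hx.1, hx.2⟩ (hb.trans_le hx.1)] at h

/-! ### Dependence on the energy -/

/-- `(u, v)` is a solution of `-h² u'' + V u = E u`, `v = u'`, which is positive and nonincreasing
on `[d, ∞)`. -/
structure IsDecayingSolution (V : ℝ → ℝ) (d h E : ℝ) (u v : ℝ → ℝ) : Prop where
  sol : IsSolutionOn (fun x => (V x - E) / h ^ 2) u v (Ici 0)
  mul_nonpos : ∀ x, d ≤ x → u x * v x ≤ 0
  pos : ∀ x, d ≤ x → 0 < u x

theorem IsNormalizedSolution.isDecayingSolution {V : ℝ → ℝ} {d h E : ℝ} {G : ℝ → ℝ} (hd : 0 ≤ d)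
    (hh : 0 < h) (hV : ∀ x, d ≤ x → V d ≤ V x) (hE : E < V d)
    (hG : IsNormalizedSolution V d h E G) {α : ℝ} (hα : 0 < α) :
    IsDecayingSolution V d h E (fun x => α * G x) (fun x => α * derivWithin G (Ici 0) x) := by
  have hs := hG.solution.isSolutionOn hh
  refine ⟨hs.const_mul α, fun x hx => ?_, fun x hx => mul_pos hα (hG.pos x hx)⟩
  have := hs.mul_nonpos_of_integrableOn hd (fun y hy => coeff_nonneg hE hV hy) hG.integrable hx
  nlinarith [mul_nonneg (sq_nonneg α) (neg_nonneg.2 this)]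

namespace IsDecayingSolution

variable {V : ℝ → ℝ} {d h E E₁ E₂ : ℝ} {u v u₁ v₁ u₂ v₂ : ℝ → ℝ}

theorem le_exp (H : IsDecayingSolution V d h E u v) (hd : 0 ≤ d)
    (hV : ∀ x, d ≤ x → V d ≤ V x) {E' : ℝ} (hEE' : E ≤ E') (hE' : E' < V d) {x : ℝ} (hx : d ≤ x) :
    u x ≤ u d * Real.exp (-(decayRate V d h E' * (x - d))) := by
  refine H.sol.le_mul_exp_of_pos hd (fun y hy => ?_) H.mul_nonpos H.pos hx
  refine (decayRate_sq_le hE' hV hy).trans ?_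
  gcongr

theorem integrableOn_sq (H : IsDecayingSolution V d h E u v) (hd : 0 ≤ d) (hh : 0 < h)
    (hV : ∀ x, d ≤ x → V d ≤ V x) (hE : E < V d) :
    IntegrableOn (fun x => u x ^ 2) (Ici 0) :=
  integrableOn_Ici_of_continuousOn (H.sol.continuousOn_fst.pow 2)
    (H.sol.integral_sq_le_of_pos hd (decayRate_pos hh hE) (fun _ hy => decayRate_sq_le hE hV hy)
      H.mul_nonpos H.pos).1

theorem integrableOn_mul (H₁ : IsDecayingSolution V d h E₁ u₁ v₁)
    (H₂ : IsDecayingSolution V d h E₂ u₂ v₂) (hd : 0 ≤ d) (hh : 0 < h)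
    (hV : ∀ x, d ≤ x → V d ≤ V x) (hE₁ : E₁ < V d) (hE₂ : E₂ < V d) :
    IntegrableOn (fun x => u₁ x * u₂ x) (Ici 0) := by
  refine Integrable.mono' ((H₁.integrableOn_sq hd hh hV hE₁).add
    (H₂.integrableOn_sq hd hh hV hE₂)) ((H₁.sol.continuousOn_fst.mul
      H₂.sol.continuousOn_fst).aestronglyMeasurable measurableSet_Ici)
    (Filter.Eventually.of_forall fun x => ?_)
  rw [Real.norm_eq_abs, abs_le]
  simp only [Pi.add_apply]
  constructor <;> nlinarith [sq_nonneg (u₁ x + u₂ x), sq_nonneg (u₁ x - u₂ x)]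

theorem snd_nonpos (H : IsDecayingSolution V d h E u v) {x : ℝ} (hx : d ≤ x) : v x ≤ 0 := by
  have h1 := H.mul_nonpos x hx
  have h2 := H.pos x hx
  by_contra! hc
  linarith [mul_pos h2 hc]

theorem abs_snd_le (H : IsDecayingSolution V d h E u v) (hd : 0 ≤ d)
    (hV : ∀ x, d ≤ x → V d ≤ V x) (hE : E < V d) {x : ℝ} (hx : d ≤ x) : |v x| ≤ -v d := by
  have hmono : MonotoneOn v (Ici d) :=
    monotoneOn_Ici_of_hasDerivAt_nonneg (H.sol.continuousOn_snd.mono (Ici_subset_Ici.2 hd))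
      (fun y hy => H.sol.hasDerivAt_snd (hd.trans_lt hy))
      fun y hy => mul_nonneg (coeff_nonneg hE hV hy.le) (H.pos y hy.le).le
  rw [abs_of_nonpos (H.snd_nonpos hx)]
  exact neg_le_neg (hmono self_mem_Ici hx hx)

theorem tendsto_zero (H : IsDecayingSolution V d h E u v) (hd : 0 ≤ d) (hh : 0 < h)
    (hV : ∀ x, d ≤ x → V d ≤ V x) (hE : E < V d) : Filter.Tendsto u Filter.atTop (𝓝 0) := by
  have hk := decayRate_pos hh hE
  have h1 : Filter.Tendsto (fun x => u d * Real.exp (-(decayRate V d h E * (x - d))))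
      Filter.atTop (𝓝 (u d * 0)) := by
    refine Filter.Tendsto.const_mul _ (Real.tendsto_exp_neg_atTop_nhds_zero.comp ?_)
    exact (Filter.tendsto_atTop_add_const_right _ (-d) Filter.tendsto_id).const_mul_atTop hk
  rw [mul_zero] at h1
  refine squeeze_zero' ?_ ?_ h1
  · filter_upwards [Filter.eventually_ge_atTop d] with x hx using (H.pos x hx).le
  · filter_upwards [Filter.eventually_ge_atTop d] with x hx using H.le_exp hd hV le_rfl hE hx

/-- The Wronskian identity for two decaying solutions with different energies. -/
theorem wronskian_eq (H₁ : IsDecayingSolution V d h E₁ u₁ v₁)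
    (H₂ : IsDecayingSolution V d h E₂ u₂ v₂) (hd : 0 ≤ d) (hh : 0 < h)
    (hV : ∀ x, d ≤ x → V d ≤ V x) (hE₁ : E₁ < V d) (hE₂ : E₂ < V d) {a : ℝ} (ha : 0 ≤ a) :
    u₁ a * v₂ a - v₁ a * u₂ a = (E₂ - E₁) / h ^ 2 * ∫ x in Ioi a, u₁ x * u₂ x := by
  have hsub : Ici a ⊆ Ici (0 : ℝ) := Ici_subset_Ici.2 ha
  have hlim : Filter.Tendsto (fun x => u₁ x * v₂ x - v₁ x * u₂ x) Filter.atTop (𝓝 0) := by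
    have key : ∀ {E E' : ℝ} {u v u' v' : ℝ → ℝ}, IsDecayingSolution V d h E u v →
        IsDecayingSolution V d h E' u' v' → E < V d → E' < V d →
        Filter.Tendsto (fun x => u x * v' x) Filter.atTop (𝓝 0) := by
      intro E E' u v u' v' H H' hE hE'
      have h1 := (H.tendsto_zero hd hh hV hE).mul_const (-v' d)
      rw [zero_mul] at h1
      refine squeeze_zero_norm' ?_ h1
      filter_upwards [Filter.eventually_ge_atTop d] with x hx
      rw [norm_mul, Real.norm_eq_abs, Real.norm_eq_abs, abs_of_pos (H.pos x hx)]
      exact mul_le_mul_of_nonneg_left (H'.abs_snd_le hd hV hE' hx) (H.pos x hx).le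
    have h1 := (key H₁ H₂ hE₁ hE₂).sub (key H₂ H₁ hE₂ hE₁)
    rw [sub_zero] at h1
    exact h1.congr fun x => by ring
  have := integral_Ioi_of_hasDerivAt_of_tendsto (a := a)
    (f := fun x => u₁ x * v₂ x - v₁ x * u₂ x)
    (f' := fun x => (E₁ - E₂) / h ^ 2 * (u₁ x * u₂ x))
    ((((H₁.sol.continuousOn_fst.mul H₂.sol.continuousOn_snd).sub
      (H₁.sol.continuousOn_snd.mul H₂.sol.continuousOn_fst)).mono hsub) a self_mem_Ici)
    (fun x hx => by
      have hx0 : 0 < x := ha.trans_lt hx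
      refine (((H₁.sol.hasDerivAt_fst hx0).mul (H₂.sol.hasDerivAt_snd hx0)).sub
        ((H₁.sol.hasDerivAt_snd hx0).mul (H₂.sol.hasDerivAt_fst hx0))).congr_deriv ?_
      ring)
    (((H₁.integrableOn_mul H₂ hd hh hV hE₁ hE₂).mono_set
      (Ioi_subset_Ici_self.trans hsub)).const_mul _) hlim
  rw [integral_const_mul] at this
  have e : (E₂ - E₁) / h ^ 2 = -((E₁ - E₂) / h ^ 2) := by ring
  rw [e]
  linarith

/-- The logarithmic derivative at `d` of the decaying solution is Lipschitz in the energy. -/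
theorem abs_snd_sub_le (H₁ : IsDecayingSolution V d h E₁ u₁ v₁)
    (H₂ : IsDecayingSolution V d h E₂ u₂ v₂) (hd : 0 ≤ d) (hh : 0 < h)
    (hV : ∀ x, d ≤ x → V d ≤ V x) (hE₁ : E₁ < V d) (hE₂ : E₂ < V d)
    (hu₁ : u₁ d = 1) (hu₂ : u₂ d = 1) :
    |v₂ d - v₁ d| ≤ |E₂ - E₁| / h ^ 2 * (1 / decayRate V d h E₁) := by
  have hw := H₁.wronskian_eq H₂ hd hh hV hE₁ hE₂ hd
  rw [hu₁, hu₂, one_mul, mul_one] at hw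
  have hk := decayRate_pos hh hE₁
  have hle : ∫ x in Ioi d, u₁ x * u₂ x ≤ 1 / decayRate V d h E₁ := by
    rw [← integral_exp_neg_sub hk d]
    refine setIntegral_mono_on ((H₁.integrableOn_mul H₂ hd hh hV hE₁ hE₂).mono_set
      fun x hx => hd.trans (le_of_lt hx)) (integrableOn_exp_neg_sub hk d d) measurableSet_Ioi
      fun x hx => ?_
    have hx' : d ≤ x := le_of_lt hx
    have h1 := H₁.le_exp hd hV le_rfl hE₁ hx'
    have h2 := H₂.le_exp hd hV le_rfl hE₂ hx'
    rw [hu₁, one_mul] at h1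
    rw [hu₂, one_mul] at h2
    have h3 : u₂ x ≤ 1 := h2.trans (Real.exp_le_one_iff.2 (neg_nonpos.2
      (mul_nonneg (decayRate_pos hh hE₂).le (sub_nonneg.2 hx'))))
    calc u₁ x * u₂ x ≤ u₁ x * 1 := mul_le_mul_of_nonneg_left h3 (H₁.pos x hx').le
      _ ≤ _ := by rw [mul_one]; exact h1
  have h0 : 0 ≤ ∫ x in Ioi d, u₁ x * u₂ x :=
    setIntegral_nonneg measurableSet_Ioi fun x hx =>
      (mul_pos (H₁.pos x (le_of_lt hx)) (H₂.pos x (le_of_lt hx))).le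
  rw [hw, abs_mul, abs_div, abs_of_nonneg h0, abs_of_pos (pow_pos hh 2)]
  gcongr

/-- Decaying solutions with value `1` at `d` are Lipschitz in the energy, uniformly on `[0, X]`:
their Cauchy data at `d` are, and Gronwall's inequality propagates this over `[0, X]`. -/
theorem exists_lipschitz (H₁ : IsDecayingSolution V d h E₁ u₁ v₁) (hd : 0 ≤ d) (hh : 0 < h)
    (hVc : ContinuousOn V (Ici 0)) (hV : ∀ x, d ≤ x → V d ≤ V x) (hE₁ : E₁ < V d)
    (hu₁ : u₁ d = 1) {X : ℝ} (hX : d ≤ X) :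
    ∃ C, 0 ≤ C ∧ ∀ E₂ ∈ Ioo 0 (V d), ∀ u₂ v₂, IsDecayingSolution V d h E₂ u₂ v₂ → u₂ d = 1 →
      ∀ x ∈ Icc 0 X, |u₂ x - u₁ x| ≤ C * |E₂ - E₁| ∧ |v₂ x - v₁ x| ≤ C * |E₂ - E₁| := by
  obtain ⟨B, hB⟩ := isCompact_Icc.exists_bound_of_continuousOn
    (hVc.mono (Icc_subset_Ici_self (a := X) (b := (0 : ℝ))))
  obtain ⟨F, hF⟩ := isCompact_Icc.exists_bound_of_continuousOn
    ((H₁.sol.continuousOn_fst.mono (Icc_subset_Ici_self (a := X))).pow 2)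
  have hdX : d ∈ Icc 0 X := ⟨hd, hX⟩
  have hF0 : 0 ≤ F := (norm_nonneg _).trans (hF d hdX)
  set k := decayRate V d h E₁ with hk
  set M := (B + V d) / h ^ 2 with hM
  set D := ((1 / h ^ 2 * (1 / k)) ^ 2 + (1 / h ^ 2) ^ 2 * F) * Real.exp ((M + 2) * X) with hD
  have hD0 : 0 ≤ D := by positivity
  refine ⟨Real.sqrt D, Real.sqrt_nonneg _, fun E₂ hE₂ u₂ v₂ H₂ hu₂ x hx => ?_⟩
  have h1 := (H₁.sol.mono (Icc_subset_Ici_self (a := X))).sq_sub_le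
    (H₂.sol.mono Icc_subset_Ici_self) (M := M) (ε := (E₁ - E₂) / h ^ 2) (F := F)
    (fun y hy => by
      have := hB y hy
      rw [abs_div, abs_of_pos (pow_pos hh 2)]
      refine div_le_div_of_nonneg_right ((abs_sub _ _).trans ?_) (pow_pos hh 2).le
      rw [abs_of_pos hE₂.1]
      exact add_le_add this hE₂.2.le)
    (fun y _ => by ring) (fun y hy => (le_abs_self _).trans (hF y hy)) hx hdX
  have h2 := H₁.abs_snd_sub_le H₂ hd hh hV hE₁ hE₂.2 hu₁ hu₂
  rw [hu₁, hu₂, sub_self, zero_pow two_ne_zero, zero_add] at h1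
  have h3 : (v₂ d - v₁ d) ^ 2 ≤ (E₂ - E₁) ^ 2 * (1 / h ^ 2 * (1 / k)) ^ 2 := by
    rw [← sq_abs (v₂ d - v₁ d), ← sq_abs (E₂ - E₁), ← mul_pow]
    refine pow_le_pow_left₀ (abs_nonneg _) (h2.trans (le_of_eq ?_)) 2
    ring
  have h4 : (u₂ x - u₁ x) ^ 2 + (v₂ x - v₁ x) ^ 2 ≤ (Real.sqrt D * |E₂ - E₁|) ^ 2 := by
    rw [mul_pow, Real.sq_sqrt hD0, sq_abs]
    refine h1.trans ?_
    have : (v₂ d - v₁ d) ^ 2 + ((E₁ - E₂) / h ^ 2) ^ 2 * F ≤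
        (E₂ - E₁) ^ 2 * ((1 / h ^ 2 * (1 / k)) ^ 2 + (1 / h ^ 2) ^ 2 * F) := by
      have e : ((E₁ - E₂) / h ^ 2) ^ 2 * F = (E₂ - E₁) ^ 2 * ((1 / h ^ 2) ^ 2 * F) := by ring
      rw [e, mul_add]
      linarith
    calc _ ≤ (E₂ - E₁) ^ 2 * ((1 / h ^ 2 * (1 / k)) ^ 2 + (1 / h ^ 2) ^ 2 * F) *
          Real.exp ((M + 2) * X) := by gcongr
      _ = _ := by rw [hD]; ring
  have h5 : 0 ≤ Real.sqrt D * |E₂ - E₁| := by positivity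
  exact ⟨abs_le_of_sq_le_sq (by nlinarith [sq_nonneg (v₂ x - v₁ x)]) h5,
    abs_le_of_sq_le_sq (by nlinarith [sq_nonneg (u₂ x - u₁ x)]) h5⟩

end IsDecayingSolution

section Family

variable {V : ℝ → ℝ} {d h : ℝ} {u v : ℝ → ℝ → ℝ}

theorem continuousAt_of_decaying_family (hd : 0 ≤ d) (hh : 0 < h) (hVc : ContinuousOn V (Ici 0))
    (hV : ∀ x, d ≤ x → V d ≤ V x)
    (H : ∀ E ∈ Ioo 0 (V d), IsDecayingSolution V d h E (u E) (v E))
    (hu : ∀ E ∈ Ioo 0 (V d), u E d = 1) {E : ℝ} (hE : E ∈ Ioo 0 (V d)) {x : ℝ} (hx : 0 ≤ x) :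
    ContinuousAt (fun E => u E x) E ∧ ContinuousAt (fun E => v E x) E := by
  obtain ⟨C, hC, hlip⟩ := (H E hE).exists_lipschitz hd hh hVc hV hE.2 (hu E hE)
    (le_max_right x d)
  have hlim : Filter.Tendsto (fun E' => C * |E' - E|) (𝓝 E) (𝓝 0) := by
    have : ContinuousAt (fun E' => C * |E' - E|) E := by fun_prop
    simpa [ContinuousAt] using this
  have hev := Ioo_mem_nhds hE.1 hE.2
  constructor
  · refine tendsto_iff_norm_sub_tendsto_zero.2 (squeeze_zero' (by simp) ?_ hlim)
    filter_upwards [hev] with E' hE'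
    exact (hlip E' hE' _ _ (H E' hE') (hu E' hE') x ⟨hx, le_max_left _ _⟩).1
  · refine tendsto_iff_norm_sub_tendsto_zero.2 (squeeze_zero' (by simp) ?_ hlim)
    filter_upwards [hev] with E' hE'
    exact (hlip E' hE' _ _ (H E' hE') (hu E' hE') x ⟨hx, le_max_left _ _⟩).2

/-- Near a given energy, the decaying solutions have a common exponentially decaying majorant. -/
theorem exists_majorant_of_decaying_family (hd : 0 ≤ d) (hh : 0 < h)
    (hVc : ContinuousOn V (Ici 0)) (hV : ∀ x, d ≤ x → V d ≤ V x)
    (H : ∀ E ∈ Ioo 0 (V d), IsDecayingSolution V d h E (u E) (v E))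
    (hu : ∀ E ∈ Ioo 0 (V d), u E d = 1) {E : ℝ} (hE : E ∈ Ioo 0 (V d)) :
    ∃ B k : ℝ, 0 < k ∧ ∀ᶠ E' in 𝓝 E, ∀ x, 0 ≤ x → |u E' x| ≤ B * Real.exp (-(k * (x - d))) := by
  obtain ⟨C, hC, hlip⟩ := (H E hE).exists_lipschitz hd hh hVc hV hE.2 (hu E hE) (le_refl d)
  obtain ⟨A, hA⟩ := isCompact_Icc.exists_bound_of_continuousOn
    ((H E hE).sol.continuousOn_fst.mono (Icc_subset_Ici_self (a := d)))
  obtain ⟨E₀, hE₀, hE₀'⟩ := exists_between hE.2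
  have hk := decayRate_pos hh hE₀'
  refine ⟨max 1 (A + C * V d), _, hk, ?_⟩
  filter_upwards [Ioo_mem_nhds hE.1 hE₀] with E' hE'
  have hE'd : E' ∈ Ioo 0 (V d) := ⟨hE'.1, hE'.2.trans hE₀'⟩
  intro x hx
  rcases le_total x d with hxd | hxd
  · have h1 := (hlip E' hE'd _ _ (H E' hE'd) (hu E' hE'd) x ⟨hx, hxd⟩).1
    have h2 := hA x ⟨hx, hxd⟩
    rw [Real.norm_eq_abs] at h2
    have h3 : |E' - E| ≤ V d := by
      rw [abs_le]; constructor <;> linarith [hE'd.1, hE'd.2, hE.1, hE.2]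
    have h4 : |u E' x| ≤ A + C * V d := by
      have : |u E' x| ≤ |u E' x - u E x| + |u E x| := by
        simpa using abs_add_le (u E' x - u E x) (u E x)
      have : C * |E' - E| ≤ C * V d := mul_le_mul_of_nonneg_left h3 hC
      linarith
    have h5 : 1 ≤ Real.exp (-(decayRate V d h E₀ * (x - d))) := by
      refine Real.one_le_exp ?_
      have := mul_nonneg hk.le (sub_nonneg.2 hxd)
      linarith
    calc |u E' x| ≤ max 1 (A + C * V d) * 1 := by
          rw [mul_one]; exact h4.trans (le_max_right _ _)
      _ ≤ _ := by gcongr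
  · have h1 := (H E' hE'd).le_exp hd hV hE'.2.le hE₀' hxd
    rw [hu E' hE'd] at h1
    rw [abs_of_pos ((H E' hE'd).pos x hxd)]
    refine h1.trans ?_
    gcongr
    exact le_max_left _ _

/-- Continuity of the overlap integral at a diagonal point `(E, E)`; the function `f` allows the
other energy either to stay fixed or to move along the diagonal. -/
theorem continuousAt_integral_mul_of_decaying_family (hd : 0 ≤ d) (hh : 0 < h)
    (hVc : ContinuousOn V (Ici 0)) (hV : ∀ x, d ≤ x → V d ≤ V x)
    (H : ∀ E ∈ Ioo 0 (V d), IsDecayingSolution V d h E (u E) (v E))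
    (hu : ∀ E ∈ Ioo 0 (V d), u E d = 1) {E : ℝ} (hE : E ∈ Ioo 0 (V d)) {f : ℝ → ℝ}
    (hf : ContinuousAt f E) (hfE : f E = E) :
    ContinuousAt (fun E' => ∫ x in Ioi 0, u (f E') x * u E' x) E := by
  obtain ⟨B, k, hk, hB⟩ := exists_majorant_of_decaying_family hd hh hVc hV H hu hE
  have hf' : Filter.Tendsto f (𝓝 E) (𝓝 E) := by simpa [ContinuousAt, hfE] using hf
  have hev := Ioo_mem_nhds hE.1 hE.2
  refine continuousAt_of_dominated (bound := fun x => B ^ 2 * Real.exp (-(2 * k * (x - d))))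
    ?_ ?_ ((integrableOn_exp_neg_sub (by positivity) d 0).const_mul _) ?_
  · filter_upwards [hev, hf' hev] with E' h1 h2
    exact (((H _ h2).sol.continuousOn_fst.mul (H _ h1).sol.continuousOn_fst).mono
      Ioi_subset_Ici_self).aestronglyMeasurable measurableSet_Ioi
  · filter_upwards [hB, hf'.eventually hB] with E' h1 h2
    filter_upwards [ae_restrict_mem measurableSet_Ioi] with x hx
    have h3 := h1 x (le_of_lt hx)
    have h4 := h2 x (le_of_lt hx)
    rw [norm_mul, Real.norm_eq_abs, Real.norm_eq_abs]
    calc |u (f E') x| * |u E' x|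
        ≤ (B * Real.exp (-(k * (x - d)))) * (B * Real.exp (-(k * (x - d)))) :=
          mul_le_mul h4 h3 (abs_nonneg _) ((abs_nonneg _).trans h4)
      _ = B ^ 2 * (Real.exp (-(k * (x - d))) * Real.exp (-(k * (x - d)))) := by ring
      _ = _ := by rw [← Real.exp_add]; ring_nf
  · filter_upwards [ae_restrict_mem measurableSet_Ioi] with x hx
    have h1 := (continuousAt_of_decaying_family hd hh hVc hV H hu hE (le_of_lt hx)).1
    exact (ContinuousAt.comp (g := fun E => u E x) (f := f) (by rwa [hfE]) hf).mul h1

end Family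

/-- A continuous nonvanishing curve `z` in the plane has a differentiable argument as soon as the
imaginary part of `conj (z s) * z t` vanishes to first order on the diagonal, with a continuous
coefficient: `z / ‖z‖` then solves a linear differential equation, which is integrated. -/
theorem exists_differentiable_arg {a b : ℝ} {z : ℝ → ℂ} {J : ℝ → ℝ → ℝ}
    (hz0 : ∀ s ∈ Ioo a b, z s ≠ 0) (hzc : ∀ s ∈ Ioo a b, ContinuousAt z s)
    (hJ : ∀ s ∈ Ioo a b, ∀ t ∈ Ioo a b,
      ((starRingEnd ℂ) (z s) * z t).im = (t - s) * J s t)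
    (hJc : ∀ s ∈ Ioo a b, ContinuousAt (J s) s)
    (hJd : ∀ s ∈ Ioo a b, ContinuousAt (fun t => J t t) s) :
    ∃ θ : ℝ → ℝ, ∀ s ∈ Ioo a b, z s = ‖z s‖ * Complex.exp (Complex.I * θ s) ∧
      HasDerivAt θ (J s s / ‖z s‖ ^ 2) s := by
  rcases (Ioo a b).eq_empty_or_nonempty with he | ⟨s₀, hs₀⟩
  · exact ⟨0, by simp [he]⟩
  set w : ℝ → ℝ := fun s => J s s / ‖z s‖ ^ 2 with hw
  set ζ : ℝ → ℂ := fun s => z s / ‖z s‖ with hζ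
  have hn0 : ∀ s ∈ Ioo a b, ‖z s‖ ≠ 0 := fun s hs => norm_ne_zero_iff.2 (hz0 s hs)
  have hζ1 : ∀ s ∈ Ioo a b, ‖ζ s‖ = 1 := fun s hs => by
    simp only [hζ, norm_div, Complex.norm_real, norm_norm]
    exact div_self (hn0 s hs)
  have hζc : ∀ s ∈ Ioo a b, ContinuousAt ζ s := fun s hs =>
    (hzc s hs).div (Complex.continuous_ofReal.continuousAt.comp (hzc s hs).norm)
      (Complex.ofReal_ne_zero.2 (hn0 s hs))
  have hwc : ∀ s ∈ Ioo a b, ContinuousAt w s := fun s hs =>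
    (hJd s hs).div ((hzc s hs).norm.pow 2) (pow_ne_zero 2 (hn0 s hs))
  have hζd : ∀ s ∈ Ioo a b, HasDerivAt ζ (ζ s * (w s * Complex.I)) s := by
    intro s hs
    set ρ : ℝ → ℂ := fun t => (starRingEnd ℂ) (ζ s) * ζ t with hρ
    have hss : (starRingEnd ℂ) (ζ s) * ζ s = 1 := by
      rw [mul_comm, Complex.mul_conj, Complex.normSq_eq_norm_sq, hζ1 s hs]; simp
    have hρs : ρ s = 1 := hss
    have hρc : ContinuousAt ρ s := continuousAt_const.mul (hζc s hs)
    have hIoo := Ioo_mem_nhds hs.1 hs.2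
    -- the imaginary part is of first order, and `‖ρ‖ = 1` makes the variation of the real part
    -- of second order
    have him : HasDerivAt (fun t => (ρ t).im) (w s) s := by
      have hψ : ContinuousAt (fun t => J s t / (‖z s‖ * ‖z t‖)) s :=
        (hJc s hs).div (continuousAt_const.mul (hzc s hs).norm)
          (mul_ne_zero (hn0 s hs) (hn0 s hs))
      rw [hasDerivAt_iff_tendsto_slope]
      have e : w s = J s s / (‖z s‖ * ‖z s‖) := by simp only [hw, sq]
      rw [e]
      refine (hψ.tendsto.mono_left nhdsWithin_le_nhds).congr' ?_
      filter_upwards [mem_nhdsWithin_of_mem_nhds hIoo, self_mem_nhdsWithin] with t ht hne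
      have hne' : t - s ≠ 0 := sub_ne_zero.2 hne
      have h1 : ρ t = ((‖z s‖ * ‖z t‖)⁻¹ : ℝ) * ((starRingEnd ℂ) (z s) * z t) := by
        simp only [hρ, hζ, map_div₀, Complex.conj_ofReal]
        push_cast
        field_simp
      rw [slope_def_field, hρs, h1, Complex.im_ofReal_mul,
        hJ s hs t ht, Complex.one_im, sub_zero]
      field_simp
    have hre : HasDerivAt (fun t => (ρ t).re) 0 s := by
      have h1 : HasDerivAt (fun t => Real.sqrt (1 - (ρ t).im ^ 2)) 0 s := by
        have := ((him.pow 2).const_sub 1).sqrt (by simp [hρs])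
        simpa [hρs] using this
      refine h1.congr_of_eventuallyEq ?_
      have hpos : ∀ᶠ t in 𝓝 s, 0 < (ρ t).re :=
        (Complex.continuous_re.continuousAt.comp hρc).eventually_const_lt (by simp [hρs])
      filter_upwards [hIoo, hpos] with t ht hp
      have h2 : (ρ t).re ^ 2 + (ρ t).im ^ 2 = 1 := by
        have : ‖ρ t‖ = 1 := by simp [hρ, hζ1 s hs, hζ1 t ht]
        have h3 := Complex.normSq_eq_norm_sq (ρ t)
        rw [this, Complex.normSq_apply] at h3
        linarith
      rw [← h2, add_sub_cancel_right, Real.sqrt_sq hp.le]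
    have hρd : HasDerivAt ρ (w s * Complex.I) s := by
      have := hre.ofReal_comp.add (him.ofReal_comp.mul_const Complex.I)
      simp only [Complex.ofReal_zero, zero_add] at this
      refine this.congr_of_eventuallyEq (Filter.Eventually.of_forall fun t => ?_)
      exact (Complex.re_add_im (ρ t)).symm
    refine (hρd.const_mul (ζ s)).congr_of_eventuallyEq (Filter.Eventually.of_forall fun t => ?_)
    simp only [hρ]
    rw [← mul_assoc, mul_comm (ζ s), hss, one_mul]
  let θ : ℝ → ℝ := fun t => (z s₀).arg + ∫ x in s₀..t, w x
  have hwco : ContinuousOn w (Ioo a b) := fun s hs => (hwc s hs).continuousWithinAt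
  have hθ : ∀ s ∈ Ioo a b, HasDerivAt θ (w s) s := fun s hs =>
    (intervalIntegral.integral_hasDerivAt_right
      (hwco.mono (ordConnected_Ioo.uIcc_subset hs₀ hs)).intervalIntegrable
      (hwco.stronglyMeasurableAtFilter isOpen_Ioo s hs) (hwc s hs)).const_add _
  have hφ : ∀ s ∈ Ioo a b,
      HasDerivAt (fun t => ζ t * Complex.exp (-(Complex.I * θ t))) 0 s := fun s hs => by
    have h1 := ((hθ s hs).ofReal_comp.const_mul Complex.I).neg.cexp
    refine ((hζd s hs).mul h1).congr_deriv ?_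
    ring
  have hconst : ∀ s ∈ Ioo a b, ζ s * Complex.exp (-(Complex.I * θ s)) = 1 := fun s hs => by
    rw [isOpen_Ioo.is_const_of_deriv_eq_zero isPreconnected_Ioo
      (fun t ht => (hφ t ht).differentiableAt.differentiableWithinAt)
      (fun t ht => (hφ t ht).deriv) hs hs₀]
    have h1 : ζ s₀ = Complex.exp (Complex.I * (z s₀).arg) := by
      simp only [hζ]
      rw [div_eq_iff (Complex.ofReal_ne_zero.2 (hn0 s₀ hs₀)), mul_comm _ (‖z s₀‖ : ℂ),
        mul_comm Complex.I]
      exact (Complex.norm_mul_exp_arg_mul_I _).symm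
    simp only [θ, intervalIntegral.integral_same, add_zero]
    rw [h1, ← Complex.exp_add, add_neg_cancel, Complex.exp_zero]
  refine ⟨θ, fun s hs => ⟨?_, hθ s hs⟩⟩
  have h1 := hconst s hs
  rw [Complex.exp_neg, mul_inv_eq_one₀ (Complex.exp_ne_zero _)] at h1
  rw [← h1]
  simp only [hζ]
  field_simp [Complex.ofReal_ne_zero.2 (hn0 s hs)]

/-! ### The phase of the Cauchy datum -/

/-- The Cauchy datum has a differentiable argument `θ` with `h |Z|² θ' = 1`. -/
theorem exists_phase {V : ℝ → ℝ} {d h : ℝ} (hd : 0 ≤ d) (hh : 0 < h) (hVc : ContinuousOn V (Ici 0))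
    (hV : ∀ x, d ≤ x → V d ≤ V x) {G : ℝ → ℝ → ℝ}
    (hG : ∀ E ∈ Ioo 0 (V d), IsNormalizedSolution V d h E (G E)) :
    ∃ θ : ℝ → ℝ, ∀ E ∈ Ioo 0 (V d),
      cauchyDatum h (G E) = ‖cauchyDatum h (G E)‖ * Complex.exp (Complex.I * θ E) ∧
      DifferentiableAt ℝ θ E ∧
      h * ‖cauchyDatum h (G E)‖ ^ 2 * deriv θ E = 1 := by
  -- the multiples normalized by the value `1` at `d` depend continuously on `E`
  let u : ℝ → ℝ → ℝ := fun E x => (G E d)⁻¹ * G E x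
  let v : ℝ → ℝ → ℝ := fun E x => (G E d)⁻¹ * derivWithin (G E) (Ici 0) x
  have hGd : ∀ E ∈ Ioo 0 (V d), 0 < G E d := fun E hE => (hG E hE).pos d le_rfl
  have H : ∀ E ∈ Ioo 0 (V d), IsDecayingSolution V d h E (u E) (v E) := fun E hE =>
    (hG E hE).isDecayingSolution hd hh hV hE.2 (inv_pos.2 (hGd E hE))
  have hu : ∀ E ∈ Ioo 0 (V d), u E d = 1 := fun E hE => inv_mul_cancel₀ (hGd E hE).ne'
  let z : ℝ → ℂ := fun E => (u E 0 : ℂ) + Complex.I * h * (v E 0 : ℝ)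
  let J : ℝ → ℝ → ℝ := fun E E' => 1 / h * ∫ x in Ioi 0, u E x * u E' x
  have hre : ∀ E, (z E).re = u E 0 := fun E => by simp [z]
  have him : ∀ E, (z E).im = h * v E 0 := fun E => by simp [z]
  have hz0 : ∀ E ∈ Ioo 0 (V d), z E ≠ 0 := fun E hE h0 => by
    have h1 : u E 0 = 0 := by rw [← hre, h0, Complex.zero_re]
    have h2 : h * v E 0 = 0 := by rw [← him, h0, Complex.zero_im]
    have h3 := (H E hE).sol.eq_zero (coeff_continuousOn hVc) le_rfl h1
      ((mul_eq_zero.1 h2).resolve_left hh.ne') hd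
    exact one_ne_zero ((hu E hE).symm.trans h3.1)
  obtain ⟨θ, hθ⟩ := exists_differentiable_arg (z := z) (J := J) hz0
    (fun E hE => by
      have h1 := continuousAt_of_decaying_family hd hh hVc hV H hu hE (le_refl 0)
      exact (Complex.continuous_ofReal.continuousAt.comp h1.1).add
        (continuousAt_const.mul (Complex.continuous_ofReal.continuousAt.comp h1.2)))
    (fun E hE E' hE' => by
      have hw := (H E hE).wronskian_eq (H E' hE') hd hh hV hE.2 hE'.2 (le_refl 0)
      rw [Complex.mul_im, Complex.conj_re, Complex.conj_im, hre, hre, him, him]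
      calc u E 0 * (h * v E' 0) + -(h * v E 0) * u E' 0
          = h * (u E 0 * v E' 0 - v E 0 * u E' 0) := by ring
        _ = _ := by
          rw [hw]
          simp only [J]
          field_simp)
    (fun E hE => continuousAt_const.mul (continuousAt_integral_mul_of_decaying_family hd hh hVc hV
      H hu hE (f := fun _ => E) continuousAt_const rfl))
    (fun E hE => continuousAt_const.mul (continuousAt_integral_mul_of_decaying_family hd hh hVc hV
      H hu hE (f := fun E => E) continuousAt_id rfl))
  refine ⟨θ, fun E hE => ?_⟩
  obtain ⟨h1, h2⟩ := hθ E hE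
  have hg := hGd E hE
  have hGu : ∀ x, G E x = G E d * u E x := fun x => by
    simp only [u]; rw [mul_inv_cancel_left₀ hg.ne']
  have hGv : derivWithin (G E) (Ici 0) 0 = G E d * v E 0 := by
    simp only [v]; rw [mul_inv_cancel_left₀ hg.ne']
  have hZ : cauchyDatum h (G E) = (G E d : ℂ) * z E := by
    simp only [cauchyDatum, z]
    rw [hGv, hGu 0]
    push_cast
    ring
  have hnZ : ‖cauchyDatum h (G E)‖ = G E d * ‖z E‖ := by
    rw [hZ, norm_mul, Complex.norm_real, Real.norm_eq_abs, abs_of_pos hg]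
  refine ⟨?_, h2.differentiableAt, ?_⟩
  · rw [hnZ]
    push_cast
    rw [mul_assoc, ← h1, hZ]
  · have hint : G E d ^ 2 * ∫ x in Ioi 0, u E x * u E x = 1 := by
      rw [← integral_const_mul, ← (hG E hE).normalized, integral_Ici_eq_integral_Ioi]
      congr 1
      ext x
      rw [hGu x]
      ring
    have hzn : ‖z E‖ ≠ 0 := norm_ne_zero_iff.2 (hz0 E hE)
    rw [hnZ, h2.deriv]
    simp only [J]
    refine Eq.trans ?_ hint
    field_simp

/-- At an eigenvalue the Cauchy datum lies on one of the coordinate axes, the same one for all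
eigenvalues of the same boundary condition; so the phases of two eigenvalues differ by a multiple
of `π`. -/
theorem sin_sub_eq_zero_of_isEigenvalue {V : ℝ → ℝ} {d h : ℝ} (hd : 0 ≤ d) (hh : 0 < h)
    (hVc : ContinuousOn V (Ici 0)) (hV : ∀ x, d ≤ x → V d ≤ V x) (bc : BoundaryCondition)
    {E E' : ℝ} (hE : E < V d) (hE' : E' < V d) {G G' : ℝ → ℝ}
    (hG : IsNormalizedSolution V d h E G) (hG' : IsNormalizedSolution V d h E' G')
    (he : IsEigenvalue bc V h E) (he' : IsEigenvalue bc V h E') {t t' : ℝ}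
    (hZ : cauchyDatum h G ≠ 0) (hZ' : cauchyDatum h G' ≠ 0)
    (ht : cauchyDatum h G = ‖cauchyDatum h G‖ * Complex.exp (Complex.I * t))
    (ht' : cauchyDatum h G' = ‖cauchyDatum h G'‖ * Complex.exp (Complex.I * t')) :
    Real.sin (t - t') = 0 := by
  have key : ∀ {E : ℝ} {G : ℝ → ℝ} {t : ℝ}, E < V d → IsNormalizedSolution V d h E G →
      IsEigenvalue bc V h E → cauchyDatum h G ≠ 0 →
      cauchyDatum h G = ‖cauchyDatum h G‖ * Complex.exp (Complex.I * t) →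
      match bc with
        | .dirichlet => Real.cos t = 0
        | .neumann => Real.sin t = 0 := by
    rintro E G t hE hG ⟨u, hu, hui, hbc, x, hx, hux⟩ hZ ht
    have hp := fun {x : ℝ} (hx : 0 ≤ x) => hu.eqOn_mul hd hh hVc hV hE hui hG hx
    have hr : u d / G d ≠ 0 := fun h0 => hux (by rw [(hp hx).1, h0, zero_mul])
    have hn : ‖cauchyDatum h G‖ ≠ 0 := norm_ne_zero_iff.2 hZ
    have hexp : Complex.exp (Complex.I * t) = Real.cos t + Real.sin t * Complex.I := by
      rw [mul_comm, Complex.exp_mul_I, Complex.ofReal_cos, Complex.ofReal_sin]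
    rw [hexp] at ht
    cases bc with
    | dirichlet =>
      have h1 : G 0 = 0 := by
        have := (hp le_rfl).1
        rw [show u 0 = 0 from hbc] at this
        exact (mul_eq_zero.1 this.symm).resolve_left hr
      have h2 := congrArg Complex.re ht
      rw [Complex.re_ofReal_mul] at h2
      simp [cauchyDatum, h1, Complex.cos_ofReal_re] at h2
      exact h2.resolve_left (by simpa [cauchyDatum, h1] using hZ)
    | neumann =>
      have h1 : derivWithin G (Ici 0) 0 = 0 := by
        have := (hp le_rfl).2
        rw [show derivWithin u (Ici 0) 0 = 0 from hbc] at this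
        exact (mul_eq_zero.1 this.symm).resolve_left hr
      have h2 := congrArg Complex.im ht
      rw [Complex.im_ofReal_mul] at h2
      simp [cauchyDatum, h1] at h2
      exact h2.resolve_left (by simpa [cauchyDatum, h1] using hZ)
  have h1 := key hE hG he hZ ht
  have h2 := key hE' hG' he' hZ' ht'
  rw [Real.sin_sub]
  cases bc with
  | dirichlet => simp only at h1 h2; rw [h1, h2]; ring
  | neumann => simp only at h1 h2; rw [h1, h2]; ring

/-! ### Uniform lower bound and spacing of the eigenvalues -/

/-- The lower bound on the Cauchy datum holds on a neighbourhood of `K` of uniform size `δ`. -/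
theorem exists_le_norm_cauchyDatum {γ b c d : ℝ} (hγ : 0 < γ) (hb : 0 < b) (hbc : b < c)
    (hcd : c < d) {𝒦 : Set (SmoothIcc d)} (h𝒦 : IsCompact 𝒦) {K : Set ℝ} (hK : IsCompact K)
    (hfull : ∀ w ∈ 𝒦, ∃ V ∈ potentialClass γ b c d 𝒦 K,
      ∃ W, IsWellPotential γ d V W ∧ w.IsRestrictionOf W) :
    ∃ C δ : ℝ, 0 < C ∧ 0 < δ ∧ ∀ V ∈ potentialClass γ b c d 𝒦 K, ∀ E ∈ K,
      E + δ ≤ V d ∧ ∀ E' : ℝ, |E' - E| ≤ δ → ∀ h : ℝ, 0 < h → h ≤ 1 →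
        ∀ G, IsNormalizedSolution V d h E' G → C ≤ ‖cauchyDatum h G‖ := by
  obtain ⟨δ, m, hδ, hm, hmar⟩ := exists_uniform_margins hγ hb hbc hcd h𝒦 hK hfull
  obtain ⟨M, hM⟩ := hK.bddAbove
  set D := (b / (δ / 2) + 1 / m + 1 / (Real.sqrt (δ / 2) * (d - c)) * (1 / m)) *
    max 1 (M + δ / 2) with hD
  have hdc : 0 < d - c := by linarith
  have hsδ : 0 < Real.sqrt (δ / 2) := Real.sqrt_pos.2 (by linarith)
  have hD0 : 0 < D := mul_pos (by positivity) (lt_of_lt_of_le one_pos (le_max_left _ _))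
  refine ⟨Real.sqrt (1 / D), δ / 2, Real.sqrt_pos.2 (by positivity), by linarith, ?_⟩
  intro V hVmem E hE
  obtain ⟨hEm, hVm⟩ := hmar V hVmem
  obtain ⟨W, hVW, -, -, -⟩ := hVmem
  obtain ⟨h1, h2⟩ := hEm E hE
  have hcd' : V c ≤ V d :=
    hVW.strictMonoOn.monotoneOn ⟨by linarith, hcd.le⟩ ⟨by linarith, le_rfl⟩ hcd.le
  refine ⟨by linarith, fun E' hE' h hh hh1 G hG => ?_⟩
  rw [abs_le] at hE'
  have key := one_le_mul_norm_cauchyDatum_sq (δ := δ / 2) (m := m) (M := M + δ / 2) hb hbc hcd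
    hVW.continuousOn hVW.zero hVW.le_of_ge hVW.deriv_pos (by linarith) hm hVm
    (by linarith [hM hE]) (by linarith) (by linarith) hh hh1 hG
  refine Real.sqrt_le_iff.2 ⟨norm_nonneg _, ?_⟩
  rw [div_le_iff₀ hD0, mul_comm]
  exact key

theorem mainTheorem3 (γ b c d : ℝ) (hγ : 0 < γ) (hb : 0 < b) (hbc : b < c) (hcd : c < d)
    (𝒦 : Set (SmoothIcc d)) (h𝒦 : IsCompact 𝒦)
    (K : Set ℝ) (hK : IsCompact K) (hKpos : K ⊆ Ioi 0)
    -- every element of `𝒦` comes from a potential of the class, so that the class is compact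
    (hfull : ∀ w ∈ 𝒦, ∃ V ∈ potentialClass γ b c d 𝒦 K,
      ∃ W, IsWellPotential γ d V W ∧ w.IsRestrictionOf W) :
    -- the normalized solution exists and is unique
    (∀ V ∈ potentialClass γ b c d 𝒦 K, ∀ h : ℝ, 0 < h → ∀ E ∈ Ioo 0 (V d),
      (∃ G, IsNormalizedSolution V d h E G) ∧
      ∀ G₁ G₂, IsNormalizedSolution V d h E G₁ → IsNormalizedSolution V d h E G₂ →
        EqOn G₁ G₂ (Ici 0)) ∧
    -- the uniform lower bound for the Cauchy datum
    (∃ C : ℝ, 0 < C ∧ ∃ h₀ : ℝ, 0 < h₀ ∧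
      ∀ V ∈ potentialClass γ b c d 𝒦 K, ∀ E ∈ K, ∀ h : ℝ, 0 < h → h ≤ h₀ →
        ∀ G, IsNormalizedSolution V d h E G → C ≤ ‖cauchyDatum h G‖) ∧
    -- the identity for the derivative of the argument of the Cauchy datum
    (∀ V ∈ potentialClass γ b c d 𝒦 K, ∀ h : ℝ, 0 < h →
      ∀ G : ℝ → ℝ → ℝ, (∀ E ∈ Ioo 0 (V d), IsNormalizedSolution V d h E (G E)) →
        ∃ θ : ℝ → ℝ, ∀ E ∈ Ioo 0 (V d),
          cauchyDatum h (G E) = ‖cauchyDatum h (G E)‖ * Complex.exp (Complex.I * θ E) ∧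
          DifferentiableAt ℝ θ E ∧
          h * ‖cauchyDatum h (G E)‖ ^ 2 * deriv θ E = 1) ∧
    -- the uniform spacing of order `h`
    (∃ C : ℝ, 0 < C ∧ ∃ h₀ : ℝ, 0 < h₀ ∧
      ∀ V ∈ potentialClass γ b c d 𝒦 K, ∀ h : ℝ, 0 < h → h ≤ h₀ →
        ∀ bc : BoundaryCondition, ∀ E ∈ K, IsEigenvalue bc V h E →
          ∀ E' : ℝ, IsEigenvalue bc V h E' → E' ≠ E → C * h ≤ |E - E'|) := by
  have hd : 0 < d := by linarith
  have hexist : ∀ V ∈ potentialClass γ b c d 𝒦 K, ∀ h : ℝ, 0 < h → ∀ E ∈ Ioo 0 (V d),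
      ∃ G, IsNormalizedSolution V d h E G := by
    rintro V ⟨W, hVW, -⟩ h hh E hE
    exact exists_isNormalizedSolution hd.le hh hVW.continuousOn hVW.le_of_ge hE.2
  obtain ⟨C, δ, hC, hδ, hmain⟩ := exists_le_norm_cauchyDatum hγ hb hbc hcd h𝒦 hK hfull
  refine ⟨fun V hV h hh E hE => ⟨hexist V hV h hh E hE, fun G₁ G₂ h₁ h₂ => ?_⟩,
    ⟨C, hC, 1, one_pos, fun V hV E hE h hh hh1 G hG => ?_⟩, fun V hV h hh G hG => ?_, ?_⟩
  · obtain ⟨W, hVW, -⟩ := hV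
    exact h₁.eqOn hd.le hh hVW.continuousOn hVW.le_of_ge hE.2 h₂
  · exact (hmain V hV E hE).2 E (by simpa using hδ.le) h hh hh1 G hG
  · obtain ⟨W, hVW, -⟩ := hV
    exact exists_phase hd.le hh hVW.continuousOn hVW.le_of_ge hG
  · -- `e` and `δ` bound the distance from `K` to `0` and to `V d`; an energy at distance less than
    -- `min e δ` from `K` has a phase, and the lower bound on the Cauchy datum applies to it
    obtain ⟨e, he, heK⟩ := hK.exists_pos_forall_le (f := fun E => E) continuousOn_id
      fun E hE => hKpos hE
    refine ⟨min (min e δ) (Real.pi * C ^ 2), by positivity, 1, one_pos, ?_⟩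
    intro V hV h hh hh1 bc E hE hev E' hev' hne
    set κ := min (min e δ) (Real.pi * C ^ 2)
    have hκ0 : 0 < κ := by positivity
    have hκe : κ ≤ e := (min_le_left _ _).trans (min_le_left _ _)
    have hκδ : κ ≤ δ := (min_le_left _ _).trans (min_le_right _ _)
    have hκπ : κ ≤ Real.pi * C ^ 2 := min_le_right _ _
    have hκh : κ * h ≤ κ := mul_le_of_le_one_right hκ0.le hh1
    by_contra! hlt
    have hclose : |E - E'| < κ := hlt.trans_le hκh
    obtain ⟨hEd, hlow⟩ := hmain V hV E hE
    have heE := heK E hE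
    rw [abs_lt] at hclose
    have hEI : E ∈ Ioo 0 (V d) := ⟨by linarith, by linarith⟩
    have hEI' : E' ∈ Ioo 0 (V d) := ⟨by linarith, by linarith⟩
    choose! G hG using hexist V hV h hh
    obtain ⟨W, hVW, -⟩ := hV
    obtain ⟨θ, hθ⟩ := exists_phase hd.le hh hVW.continuousOn hVW.le_of_ge hG
    have hZ0 : ∀ t ∈ Ioo 0 (V d), cauchyDatum h (G t) ≠ 0 := fun t ht h0 => by
      have := (hθ t ht).2.2
      rw [h0] at this
      simp at this
    have hsin := sin_sub_eq_zero_of_isEigenvalue hd.le hh hVW.continuousOn hVW.le_of_ge bc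
      hEI.2 hEI'.2 (hG E hEI) (hG E' hEI') hev hev' (hZ0 E hEI) (hZ0 E' hEI')
      (hθ E hEI).1 (hθ E' hEI').1
    have hsub : uIcc E E' ⊆ Ioo 0 (V d) := ordConnected_Ioo.uIcc_subset hEI hEI'
    have hderiv : ∀ t ∈ Ioo 0 (V d), 0 < deriv θ t := fun t ht => by
      have h1 := (hθ t ht).2.2
      have h2 : 0 < h * ‖cauchyDatum h (G t)‖ ^ 2 := by
        have := norm_pos_iff.2 (hZ0 t ht)
        positivity
      by_contra! hc
      linarith [mul_nonpos_of_nonneg_of_nonpos h2.le hc]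
    have hmono : StrictMonoOn θ (Ioo 0 (V d)) :=
      strictMonoOn_of_deriv_pos (convex_Ioo _ _)
        (fun t ht => (hθ t ht).2.1.continuousAt.continuousWithinAt)
        fun t ht => hderiv t (interior_subset ht)
    have hθne : θ E - θ E' ≠ 0 := sub_ne_zero.2 fun h0 => hne (hmono.injOn hEI hEI' h0).symm
    have hπ : Real.pi ≤ |θ E - θ E'| := by
      obtain ⟨n, hn⟩ := Real.sin_eq_zero_iff.1 hsin
      rw [← hn, abs_mul, abs_of_pos Real.pi_pos]
      have : (1 : ℝ) ≤ |(n : ℝ)| := by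
        have hn0 : n ≠ 0 := by
          rintro rfl
          exact hθne (by rw [← hn]; simp)
        exact_mod_cast Int.one_le_abs hn0
      nlinarith [Real.pi_pos]
    have hLip : |θ E - θ E'| ≤ 1 / (h * C ^ 2) * |E - E'| := by
      refine (convex_uIcc E E').norm_image_sub_le_of_norm_deriv_le
        (fun t ht => (hθ t (hsub ht)).2.1) (fun t ht => ?_) right_mem_uIcc left_mem_uIcc
      have ht' := hsub ht
      have h1 := (hθ t ht').2.2
      have h2 : C ≤ ‖cauchyDatum h (G t)‖ := by
        refine hlow t ?_ h hh hh1 _ (hG t ht')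
        have h3 := abs_sub_left_of_mem_uIcc ht
        rw [abs_sub_comm E' E] at h3
        exact h3.trans (by linarith [hlt.trans_le hκh])
      rw [Real.norm_eq_abs, abs_of_pos (hderiv t ht'), le_div_iff₀ (by positivity), ← h1, mul_comm]
      have := hderiv t ht'
      gcongr
    have hfin := hπ.trans hLip
    rw [one_div, inv_mul_eq_div, le_div_iff₀ (by positivity)] at hfin
    nlinarith [mul_le_mul_of_nonneg_right hκπ hh.le]
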